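/- Let $\Xi$ be a connected smooth Riemannian manifold (second countable, without boundary) with its Riemannian distance and volume measure $\mu$. Let $\mathcal S$ be the space of locally finite point configurations $\xi\subset\Xi$ (finitely many points in every bounded set), with the $\sigma$-algebra generated by the counts $\xi\mapsto\#(\xi\cap B)$, $B$ Borel, and let $\Pi$ be a (simple) point process on $\Xi$, i.e. a random element of $\mathcal S$, with law $\mathbb P$. For a configuration $\xi$ let $[\xi]$ be its counting measure and $[\xi]^{\wedge r}$ the counting measure on ordered $r$-tuples of distinct points of $\xi$. For a vector $\zeta=(\zeta_1,\dots,\zeta_r)$ put $\delta_\zeta=\sum_i\delta_{\zeta_i}$, and for a function $\varphi:\Xi\to\mathbb C$ write $\Lambda(\varphi)[\nu]=\int\varphi\,d\nu$ for a counting measure $\nu$ (and $\Lambda(\varphi)[\xi]=\Lambda(\varphi)[[\xi]]$). *Palm measures.* The $r$-point intensity measure is $\rho_r(A)=\mathbb E\,[\Pi]^{\wedge r}(A)$, and the $r$-point Campbell measure $\mu^{(r)}$ on $\Xi^r\times\mathcal S$ is given by $\int f\,d\mu^{(r)}=\int\!\int f(s,\xi)\,d[\xi]^{\wedge r}(s)\,d\mathbb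 P(\xi)$. Let $\{\overline{\mathbb P}_{s}\}$ be any measurable family of probability measures with $d\mu^{(r)}(s,\xi)=d\rho_r(s)\,d\overline{\mathbb P}_{s}(\xi)$; it is determined for $\rho_r$-a.e. $s$. The (reduced) Palm measure $\mathbb P_{s}$ is the law of $\xi\setminus\{s_1,\dots,s_r\}$ when $\xi$ has law $\overline{\mathbb P}_{s}$. *Rigidity.* For $D\subset\Xi$ bounded and open write $\Pi_{\rm in}=\Pi\cap D$ and $\Pi_{\rm out}=\Pi\setminus D$. The statistic $\Lambda(\varphi)[\Pi_{\rm in}]$ is rigid if it equals almost surely a measurable function of $\Pi_{\rm out}$. *Tolerance.* Let $\Phi_0\equiv1,\Phi_1,\dots,\Phi_k$ be smooth functions $\Xi\to\mathbb C$ such that the statistics $\Lambda(\Phi_j)[\Pi_{\rm in}]$ are rigid, with $\Lambda(\Phi_0)[\Pi_{\rm in}]=N(\Pi_{\rm out})$ and $\Lambda(\Phi_j)[\Pi_{\rm in}]=S_j(\Pi_{\rm out})$ a.s. For $N\ge0$ and $s\in\mathbb C^k$ let $\Sigma_{N,s}=\{\zeta\in D^N:\Lambda(\Phi_j)[\delta_\zeta]=s_j,\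 1\le j\le k\}$. Then $\Pi$ is tolerant on $D$ subject to these statistics if, for almost every value $\omega$ of $\Pi_{\rm out}$, the set $\Sigma_{N(\omega),S(\omega)}$ is an embedded submanifold (of some dimension) of $\Xi^{N(\omega)}$, and the regular conditional distribution of $\Pi_{\rm in}$ given $\Pi_{\rm out}=\omega$ is mutually absolutely continuous with the image of the Riemannian volume of $\Sigma_{N(\omega),S(\omega)}$ under $\zeta\mapsto\{\zeta_1,\dots,\zeta_{N(\omega)}\}$. **Theorem.** Suppose that for every $r$ the intensity measure $\rho_r$ is $\sigma$-finite and absolutely continuous with respect to $\mu^{\otimes r}$. Let $\Phi_0,\dots,\Phi_k:\Xi\to\mathbb C$ be smooth, $\Phi_0\equiv1$, and suppose that for every bounded open set $D\subset\Xi$ the linear statistics $\Lambda(\Phi_0)[\Pi_{\rm in}],\dots,\Lambda(\Phi_k)[\Pi_{\rm in}]$ are rigid and $\Pi$ is tolerant on $D$ subject to them. Then, for all $m,n\ge 0$ and for $\mu^{\otimes m}\otimes\mu^{\otimes n}$-a.e. pair $(\zeta_1,\zeta_2)\in\Xi^m\times\Xi^n$ at which the densities $d\rho_m/d\mu^{\otimes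 m}(\zeta_1)$ and $d\rho_n/d\mu^{\otimes n}(\zeta_2)$ are both nonzero, the Palm measures $\mathbb P_{\zeta_1}$ and $\mathbb P_{\zeta_2}$ are mutually absolutely continuous if $\Lambda(\Phi_i)[\delta_{\zeta_1}]=\Lambda(\Phi_i)[\delta_{\zeta_2}]$ for all $0\le i\le k$, and they are mutually singular otherwise. -/

import Mathlib

open MeasureTheory ProbabilityTheory Set Manifold
open scoped ENNReal ContDiff Bundle

noncomputable section

/-- A (simple) locally finite point configuration on a metric space `X`:
a set of points that has only finitely many points in each bounded set. -/
structure PointConfig (X : Type*) [MetricSpace X] where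
  carrier : Set X
  finite_inter : ∀ B : Set X, Bornology.IsBounded B → (carrier ∩ B).Finite

namespace PointConfig

variable {X : Type*} [MetricSpace X]

/-- The part `ξ ∩ A` of a configuration that lies in `A`. -/
def restrict (A : Set X) (ξ : PointConfig X) : PointConfig X where
  carrier := ξ.carrier ∩ A
  finite_inter := fun B hB =>
    (ξ.finite_inter B hB).subset fun _ hx => ⟨hx.1.1, hx.2⟩

/-- The configuration formed by the coordinates of a vector of finite length. -/
def ofVector {N : ℕ} (ζ : Fin N → X) : PointConfig X where
  carrier := Set.range ζ
  finite_inter := fun _ _ => (Set.finite_range ζ).subset Set.inter_subset_left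

variable [MeasurableSpace X]

/-- The counting measure `[ξ]` with an atom of mass one at each point of `ξ`. -/
def countingMeasure (ξ : PointConfig X) : Measure X :=
  Measure.count.restrict ξ.carrier

/-- The usual σ-algebra on the space of configurations: the smallest one for which all the counts
`ξ ↦ [ξ](B)`, with `B` a measurable set, are measurable. -/
instance : MeasurableSpace (PointConfig X) :=
  MeasurableSpace.comap countingMeasure inferInstance

/-- The counting measure `[ξ]^{∧ r}` on the ordered `r`-tuples of distinct points of `ξ`. -/
def factorialMeasure (r : ℕ) (ξ : PointConfig X) : Measure (Fin r → X) :=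
  Measure.count.restrict {s | Function.Injective s ∧ ∀ i, s i ∈ ξ.carrier}

end PointConfig

section Palm

variable {X : Type*} [MetricSpace X] [MeasurableSpace X]

/-- The `r`-point intensity measure `ρ_r(A) = E [ξ]^{∧ r}(A)` of the point process with law `P`. -/
def intensityMeasure (P : Measure (PointConfig X)) (r : ℕ) : Measure (Fin r → X) :=
  P.bind fun ξ => ξ.factorialMeasure r

/-- The `r`-point Campbell measure of the point process with law `P`:
`∫ f(s, ξ) dμ⁽ʳ⁾(s, ξ) = ∫ (∫ f(s, ξ) d[ξ]^{∧ r}(s)) dP(ξ)`. -/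
def campbellMeasure (P : Measure (PointConfig X)) (r : ℕ) :
    Measure ((Fin r → X) × PointConfig X) :=
  P.bind fun ξ => (ξ.factorialMeasure r).map fun s => (s, ξ)

/-- `Q` is a version of the family of the `r`-point Palm measures (which still contain the points
of the conditioning vector): a probability kernel with `dμ⁽ʳ⁾(s, ξ) = dρ_r(s) dQ_s(ξ)`. -/
def IsPalmFamily (P : Measure (PointConfig X)) (r : ℕ)
    (Q : Kernel (Fin r → X) (PointConfig X)) : Prop :=
  IsMarkovKernel Q ∧ campbellMeasure P r = (intensityMeasure P r) ⊗ₘ Q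

/-- The reduced Palm measure at `ζ`: the law of `ξ ∖ ζ` when `ξ` has the law `Q ζ`. -/
def reducedPalm {r : ℕ} (Q : Kernel (Fin r → X) (PointConfig X)) (ζ : Fin r → X) :
    Measure (PointConfig X) :=
  (Q ζ).map (PointConfig.restrict (Set.range ζ)ᶜ)

end Palm

section Rigidity

variable {X : Type*} [MetricSpace X] [MeasurableSpace X]

/-- The linear statistic `Λ(φ)[m] = ∫ φ dm` of a counting measure `m`. -/
def linearStatistic (φ : X → ℂ) (m : Measure X) : ℂ :=
  ∫ x, φ x ∂m

/-- The counting measure `δ_ζ` of the coordinates of a vector, counted with multiplicity. -/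
def vectorMeasure {N : ℕ} (ζ : Fin N → X) : Measure X :=
  ∑ i, Measure.dirac (ζ i)

/-- The linear statistic `Λ(φ)` of the part of the process inside `D` is rigid: it is almost surely
a measurable function of the part outside `D`. -/
def IsRigidStatistic (P : Measure (PointConfig X)) (D : Set X) (φ : X → ℂ) : Prop :=
  ∃ fOut : PointConfig X → ℂ, Measurable fOut ∧
    ∀ᵐ ξ ∂P, linearStatistic φ (ξ.restrict D).countingMeasure = fOut (ξ.restrict Dᶜ)

/-- The set `Σ_{N,s}` of vectors in `D^N` whose linear statistics are prescribed by `s`. -/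
def constraintSet {t : ℕ} (Ψ : Fin t → X → ℂ) (D : Set X) (N : ℕ) (s : Fin t → ℂ) :
    Set (Fin N → X) :=
  {ζ | (∀ i, ζ i ∈ D) ∧ ∀ j, linearStatistic (Ψ j) (vectorMeasure ζ) = s j}

/-- Mutual absolute continuity of two measures. -/
def MutuallyAC {Ω : Type*} [MeasurableSpace Ω] (μ ν : Measure Ω) : Prop :=
  μ ≪ ν ∧ ν ≪ μ

end Rigidity

section Riemannian

/-- The Riemannian volume measure of a Riemannian manifold modelled on `E`: the Hausdorff measure
of dimension `dim E` for the Riemannian distance, normalised to be Lebesgue measure on Euclidean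
space. -/
def riemannianVolume (E : Type*) [NormedAddCommGroup E] [NormedSpace ℝ E]
    (M : Type*) [MetricSpace M] [MeasurableSpace M] [BorelSpace M] : Measure M :=
  Measure.euclideanHausdorffMeasure (Module.finrank ℝ E)

/-- `S` is an embedded smooth submanifold of dimension `p` of the product manifold `M^N`: near each
of its points it is the image of an open subset of `ℝ^p` under a smooth immersion (smooth in each
coordinate) that is a homeomorphism onto its image. -/
def IsEmbeddedSubmanifold (E : Type*) [NormedAddCommGroup E] [NormedSpace ℝ E]
    {M : Type*} [TopologicalSpace M] [ChartedSpace E M] {N : ℕ} (p : ℕ)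
    (S : Set (Fin N → M)) : Prop :=
  ∀ z ∈ S, ∃ (U : Set (Fin N → M)) (V : Set (EuclideanSpace ℝ (Fin p)))
    (f : EuclideanSpace ℝ (Fin p) → Fin N → M),
    IsOpen U ∧ z ∈ U ∧ IsOpen V ∧ f '' V = S ∩ U ∧
    Topology.IsEmbedding (V.domRestrict f) ∧
    (∀ i, ContMDiffOn 𝓘(ℝ, EuclideanSpace ℝ (Fin p)) 𝓘(ℝ, E) ∞ (fun v => f v i) V) ∧
    ∀ v ∈ V, ∀ w : TangentSpace 𝓘(ℝ, EuclideanSpace ℝ (Fin p)) v,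
      (∀ i, mfderiv 𝓘(ℝ, EuclideanSpace ℝ (Fin p)) 𝓘(ℝ, E) (fun v => f v i) v w = 0) → w = 0

/-- The Riemannian volume measure of a `p`-dimensional submanifold `S` of the product `M^N`, as a
measure on `M^N`: the normalised `p`-dimensional Hausdorff measure on `S` for the `ℓ²` product
of the Riemannian distances, which is the distance of the product Riemannian metric. -/
def submanifoldVolume {M : Type*} [MetricSpace M] [MeasurableSpace M] [BorelSpace M]
    [SecondCountableTopology M] {N : ℕ} (p : ℕ) (S : Set (Fin N → M)) : Measure (Fin N → M) :=
  ((Measure.euclideanHausdorffMeasure p : Measure (PiLp 2 fun _ : Fin N => M)).map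
    WithLp.ofLp).restrict S

/-- Tolerance of the point process with law `P` on the Riemannian manifold `M`, for the set `D`,
subject to the rigid linear statistics `Λ(Φ_0), …, Λ(Φ_t)` of the inside part (with `Φ_0 ≡ 1`).
Here `s j (η)` is the value of the `j`-th statistic inside `D` when the outside part is `η`, the
kernel `κ` is the conditional distribution of the inside part given the outside part, and for
almost every outside part `η`, with `N = s 0 (η)` the number of points inside, `κ η` is mutually
absolutely continuous with the image on configurations of the volume of the submanifold
`Σ_{N, (s 1 η, …, s t η)}` of `D^N`. -/
def IsTolerant (E : Type*) [NormedAddCommGroup E] [NormedSpace ℝ E]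
    {M : Type*} [MetricSpace M] [ChartedSpace E M] [MeasurableSpace M] [BorelSpace M]
    [SecondCountableTopology M] (P : Measure (PointConfig M)) (D : Set M) {t : ℕ}
    (Φ : Fin (t + 1) → M → ℂ) : Prop :=
  ∃ (s : Fin (t + 1) → PointConfig M → ℂ) (κ : Kernel (PointConfig M) (PointConfig M)),
    (∀ j, Measurable (s j)) ∧
    (∀ j, ∀ᵐ ξ ∂P,
      linearStatistic (Φ j) (ξ.restrict D).countingMeasure = s j (ξ.restrict Dᶜ)) ∧
    IsMarkovKernel κ ∧
    P.map (fun ξ => (ξ.restrict Dᶜ, ξ.restrict D)) =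
      (P.map (PointConfig.restrict Dᶜ)) ⊗ₘ κ ∧
    ∀ᵐ η ∂(P.map (PointConfig.restrict Dᶜ)), ∃ N p : ℕ,
      (N : ℂ) = s 0 η ∧
      IsEmbeddedSubmanifold E p
        (constraintSet (fun j : Fin t => Φ j.succ) D N fun j => s j.succ η) ∧
      MutuallyAC (κ η)
        ((submanifoldVolume p
          (constraintSet (fun j : Fin t => Φ j.succ) D N fun j => s j.succ η)).map
          PointConfig.ofVector)

end Riemannian

end

set_option linter.unusedSectionVars false

/-! Let C be the reduced Campbell measure on pairs (s, ξ ∖ s), where s runs through the m-tuples of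
distinct points of ξ and ξ has law P. It disintegrates over ρ_m into the reduced Palm measures
(`IsPalmFamily.bind_splitKernel_eq`), so the null sets of almost every Palm measure can be read off
from C.

Singularity. If D contains ζ, removing ζ leaves the outside of D unchanged and lowers the inside
statistic by Λ(Φ_i)[δ_ζ]. Hence under the Palm measure at ζ the value predicted by the outside,
minus the inside statistic, is almost surely the constant Λ(Φ_i)[δ_ζ]
(`IsPalmFamily.ae_statistic_eq`). Two different constants in one large window separate two Palm
measures.

Equivalence. Let ν be the m-th power of the volume and S(ζ) the vector of statistics. By Fubini, for
almost every pair with S(ζ₁) = S(ζ₂) the common value is an atom of the image of ν under S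
(`ae_prod_eq_imp_pos`), and there are countably many atoms. So one value v and a set G ⊆ {S = v} in
D^m with ν(G) > 0 may be fixed, and no fibres of S of measure zero have to be studied. Given the
outside, the inside has the null sets of the volume of a constraint set Σ_{N,s}. Statistics are
additive, so once m of the points lie in G the other l = N - m points range over Σ_{l,s-v}, whatever
the first m are: above G the constraint set is a product G × T.

The core is `hausdorffMeasure_restrict_prod_mutuallyAC`: on G × T the p-dimensional Hausdorff
measure has the null sets of ν on G times the (p - md)-dimensional Hausdorff measure on T, d being
the dimension of the manifold. One direction is Eilenberg's inequality for slices, the other a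
covering estimate for rectangles; T needs no smoothness. After mixing over the outside, C has over G
the null sets of a product ν × τ, so almost every Palm measure over the part of G with nonzero
density is equivalent to the single measure τ. -/

noncomputable section

/-! ### Hausdorff measures on products. -/

section HausdorffProduct

open Filter Topology Metric Measure
open scoped NNReal

variable {X Y : Type*} [MetricSpace X] [SecondCountableTopology X] [MeasurableSpace X]
  [BorelSpace X] [MetricSpace Y] [SecondCountableTopology Y] [MeasurableSpace Y] [BorelSpace Y]

/-- A set of finite Hausdorff measure has fine coverings whose sums are almost optimal. -/
theorem exists_cover_tsum_le_hausdorffMeasure (d : ℝ) {E : Set X} (hE : μH[d] E ≠ ⊤)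
    {δ : ℝ≥0∞} (hδ : 0 < δ) :
    ∃ t : ℕ → Set X, E ⊆ ⋃ n, t n ∧ (∀ n, ediam (t n) ≤ δ) ∧
      ∑' n, ⨆ _ : (t n).Nonempty, ediam (t n) ^ d ≤ μH[d] E + δ := by
  have h1 : (⨅ (t : ℕ → Set X) (_ : E ⊆ ⋃ n, t n) (_ : ∀ n, ediam (t n) ≤ δ),
      ∑' n, ⨆ _ : (t n).Nonempty, ediam (t n) ^ d) < μH[d] E + δ := by
    refine lt_of_le_of_lt ?_ (ENNReal.lt_add_right hE hδ.ne')
    rw [hausdorffMeasure_apply]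
    exact le_iSup₂_of_le δ hδ le_rfl
  simp only [iInf_lt_iff] at h1
  obtain ⟨t, ht, ht', h⟩ := h1
  exact ⟨t, ht, ht', h.le⟩

/-- Eilenberg's inequality for the slices of a set in a product, when the measure `ν` on the first
factor grows at most like the power `a` of the diameter. -/
theorem exists_lintegral_hausdorffMeasure_slice_le {ν : Measure X} {U : Set X} {a q : ℝ}
    (ha : 0 ≤ a) (hq : 0 ≤ q) {C : ℝ≥0} (hν : ∀ S ⊆ U, ν S ≤ C * ediam S ^ a)
    {E : Set (X × Y)} (hEU : E ⊆ U ×ˢ univ) (hE : μH[a + q] E ≠ ⊤) :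
    ∃ g : X → ℝ≥0∞, Measurable g ∧ (∀ x, μH[q] {y | (x, y) ∈ E} ≤ g x) ∧
      ∫⁻ x, g x ∂ν ≤ C * μH[a + q] E := by
  set δ : ℕ → ℝ≥0∞ := fun n => ((n : ℝ≥0∞) + 1)⁻¹ with hδdef
  have hδ : ∀ n, 0 < δ n := fun n => by simp [hδdef]
  have hδt : Tendsto δ atTop (𝓝 0) := by
    have := (tendsto_add_atTop_iff_nat 1).2 ENNReal.tendsto_inv_nat_nhds_zero
    simpa [hδdef] using this
  choose t ht htd hts using fun n => exists_cover_tsum_le_hausdorffMeasure (a + q) hE (hδ n)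
  -- The shadow A n i of a covering piece need not be measurable. Its measurable hull B n i has the
  -- same ν-measure and makes g n measurable.
  set A : ℕ → ℕ → Set X := fun n i => Prod.fst '' t n i ∩ U
  set B : ℕ → ℕ → Set X := fun n i => toMeasurable ν (A n i)
  set g : ℕ → X → ℝ≥0∞ := fun n x => ∑' i, (B n i).indicator (fun _ => ediam (t n i) ^ q) x
  have hgm : ∀ n, Measurable (g n) := fun n => Measurable.tsum fun i =>
    measurable_const.indicator (measurableSet_toMeasurable _ _)
  -- The slice at x is covered by the slices of the pieces whose shadow contains x, so g n x bounds
  -- the sum for that covering. Fatou's lemma then bounds the integral of the liminf.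
  refine ⟨fun x => liminf (fun n => g n x) atTop, .liminf hgm, fun x => ?_, ?_⟩
  · by_cases hx : x ∈ U
    · have hsl : ∀ n i, ediam {y | (x, y) ∈ t n i} ≤ ediam (t n i) := fun n i => by
        refine ediam_le fun y hy z hz => ?_
        refine le_trans ?_ (edist_le_ediam_of_mem (s := t n i) hy hz)
        simp [Prod.edist_eq]
      refine (hausdorffMeasure_le_liminf_tsum (ι := fun n => {i : ℕ // x ∈ A n i}) q _ δ hδt
        (fun n i => {y | (x, y) ∈ t n i}) (.of_forall fun n i => (hsl n i).trans (htd n i))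
        (.of_forall fun n y hy => ?_)).trans ?_
      · obtain ⟨i, hi⟩ := mem_iUnion.1 (ht n hy)
        exact mem_iUnion.2 ⟨⟨i, ⟨_, hi, rfl⟩, hx⟩, hi⟩
      · refine liminf_le_liminf (.of_forall fun n => ?_)
        have h1 : ∑' i : {i : ℕ // x ∈ A n i}, ediam {y | (x, y) ∈ t n i} ^ q ≤
            ∑' i : {i : ℕ // x ∈ A n i}, (B n i).indicator (fun _ => ediam (t n i) ^ q) x := by
          refine ENNReal.tsum_le_tsum fun i => ?_
          rw [indicator_of_mem (subset_toMeasurable _ _ i.2)]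
          exact ENNReal.rpow_le_rpow (hsl n i) hq
        refine h1.trans ?_
        exact ENNReal.tsum_comp_le_tsum_of_injective (f := fun i : {i : ℕ // x ∈ A n i} => (i : ℕ))
          Subtype.val_injective (fun i => (B n i).indicator (fun _ => ediam (t n i) ^ q) x)
    · have : {y | (x, y) ∈ E} = ∅ := by
        ext y; simp only [mem_ofPred_eq, mem_empty_iff_false, iff_false]
        exact fun h => hx (hEU h).1
      simp [this]
  · refine (lintegral_liminf_le hgm).trans ?_
    have hle : ∀ n, ∫⁻ x, g n x ∂ν ≤ C * (μH[a + q] E + δ n) := fun n => by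
      rw [lintegral_tsum fun i =>
        (measurable_const.indicator (measurableSet_toMeasurable _ _)).aemeasurable]
      refine le_trans ?_ (mul_le_mul_right (hts n) _)
      rw [← ENNReal.tsum_mul_left]
      refine ENNReal.tsum_le_tsum fun i => ?_
      rw [lintegral_indicator_const (measurableSet_toMeasurable _ _), measure_toMeasurable]
      rcases (t n i).eq_empty_or_nonempty with h0 | h0
      · simp [A, h0]
      · simp only [h0, ciSup_pos]
        have h2 : ν (A n i) ≤ C * ediam (t n i) ^ a := by
          refine (hν _ inter_subset_right).trans ?_
          gcongr
          refine (ediam_mono inter_subset_left).trans ?_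
          simpa using LipschitzWith.prod_fst.ediam_image_le (t n i)
        rw [ENNReal.rpow_add_of_nonneg _ _ ha hq, mul_comm (ediam _ ^ q)]
        calc _ ≤ C * ediam (t n i) ^ a * ediam (t n i) ^ q := by gcongr
          _ = _ := by ring
    refine (liminf_le_liminf (.of_forall hle)).trans (le_of_eq ?_)
    refine Tendsto.liminf_eq ?_
    have : Tendsto (fun n => C * (μH[a + q] E + δ n)) atTop (𝓝 (C * (μH[a + q] E + 0))) :=
      ENNReal.Tendsto.const_mul (tendsto_const_nhds.add hδt) (Or.inr ENNReal.coe_ne_top)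
    simpa using this


/-- A covering piece may have diameter zero. It is given a positive size at a small cost in the q-th
power, so that cubes of that size can be used. -/
theorem exists_nnreal_ge_rpow_le_add {D ε : ℝ≥0∞} {δ : ℝ≥0} (q : ℝ) (hδ : 0 < δ) (hD : D ≤ δ)
    (hε : ε ≠ 0) (hq : 0 ≤ q) :
    ∃ r : ℝ≥0, 0 < r ∧ D ≤ r ∧ r ≤ 2 * δ ∧ (r : ℝ≥0∞) ^ q ≤ D ^ q + ε := by
  lift D to ℝ≥0 using ne_top_of_le_ne_top ENNReal.coe_ne_top hD
  have hcont : Continuous fun s : ℝ≥0 => ((D + s : ℝ≥0) : ℝ≥0∞) ^ q :=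
    (ENNReal.continuous_rpow_const).comp (ENNReal.continuous_coe.comp (by fun_prop))
  have h1 : ∀ᶠ s : ℝ≥0 in 𝓝 0, ((D + s : ℝ≥0) : ℝ≥0∞) ^ q < (D : ℝ≥0∞) ^ q + ε := by
    refine (hcont.tendsto 0).eventually (gt_mem_nhds ?_)
    simp only [add_zero]
    exact ENNReal.lt_add_right (ENNReal.rpow_ne_top_of_nonneg hq ENNReal.coe_ne_top) hε
  obtain ⟨η, hη, h⟩ := NNReal.nhds_zero_basis.eventually_iff.1 h1
  refine ⟨D + min (η / 2) δ, ?_, ?_, ?_, (h ?_).le⟩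
  · have : 0 < min (η / 2) δ := lt_min (half_pos hη) hδ
    positivity
  · exact_mod_cast le_self_add
  · rw [two_mul]; exact add_le_add (by exact_mod_cast hD) (min_le_right _ _)
  · exact (min_le_left _ _).trans_lt (NNReal.half_lt_self hη.ne')

/-- Above a piece t i of T, the set S is cut into cubes of side r i, slightly more than the diameter
of t i; in the sup metric cube × t i then has diameter at most r i. About (l / r i) ^ card ι cubes
are needed, which turns r i ^ (card ι + q) into l ^ card ι * r i ^ q. -/
theorem exists_cover_prod_of_ediam_le {ι : Type} [Fintype ι] {q : ℝ} (hq : 0 ≤ q)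
    {S : Set (ι → ℝ)} {l : ℝ≥0} (hS : ediam S ≤ l) {T : Set Y} (hT : μH[q] T ≠ ⊤)
    {δ : ℝ≥0} (hδ : 0 < δ) :
    ∃ (J : Type) (_ : Countable J) (s : J → Set ((ι → ℝ) × Y)), S ×ˢ T ⊆ ⋃ j, s j ∧
      (∀ j, ediam (s j) ≤ (2 * δ : ℝ≥0)) ∧
      ∑' j, ediam (s j) ^ (Fintype.card ι + q) ≤
        ((l + 2 * δ : ℝ≥0) : ℝ≥0∞) ^ Fintype.card ι * (μH[q] T + δ + δ) := by
  classical
  have hδ' : (0 : ℝ≥0∞) < δ := by exact_mod_cast hδ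
  obtain ⟨t, ht, htd, hts⟩ := exists_cover_tsum_le_hausdorffMeasure q hT hδ'
  obtain ⟨ε, hε, hεs⟩ := ENNReal.exists_pos_sum_of_countable hδ'.ne' ℕ
  choose r hr0 hrd hrδ hrq using fun i : ℕ =>
    exists_nnreal_ge_rpow_le_add q hδ (htd i) (ε := ε i) (by exact_mod_cast (hε i).ne') hq
  rcases S.eq_empty_or_nonempty with rfl | ⟨x₀, hx₀⟩
  · exact ⟨Empty, inferInstance, Empty.elim, by simp, by simp, by simp⟩
  have hdist : ∀ x ∈ S, ∀ y ∈ S, ∀ c, |x c - y c| ≤ l := fun x hx y hy c => by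
    have h1 : edist x y ≤ l := (edist_le_ediam_of_mem hx hy).trans hS
    have h2 : dist x y ≤ l := by rw [edist_nndist] at h1; exact_mod_cast h1
    exact (Real.dist_eq _ _ ▸ dist_le_pi_dist x y c).trans h2
  set m : ι → ℝ := fun c => sInf ((fun x : ι → ℝ => x c) '' S) with hm
  have hbdd : ∀ c, BddBelow ((fun x : ι → ℝ => x c) '' S) := fun c => by
    refine ⟨x₀ c - l, ?_⟩
    rintro _ ⟨y, hy, rfl⟩
    have := abs_le.1 (hdist x₀ hx₀ y hy c)
    simp only; linarith [this.2]
  have hm1 : ∀ x ∈ S, ∀ c, m c ≤ x c := fun x hx c => csInf_le (hbdd c) ⟨x, hx, rfl⟩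
  have hm2 : ∀ x ∈ S, ∀ c, x c - m c ≤ l := fun x hx c => by
    have : x c - l ≤ m c := le_csInf ⟨_, x₀, hx₀, rfl⟩ (by
      rintro _ ⟨y, hy, rfl⟩
      have := abs_le.1 (hdist x hx y hy c)
      simp only; linarith [this.2])
    linarith
  -- The extra interval makes the k i closed intervals of length r i starting at m c reach past a
  -- range of length l. Their total length is at most l + r i, hence at most l + 2δ.
  let k : ℕ → ℕ := fun i => ⌊(l : ℝ) / r i⌋₊ + 1
  let cube : (i : ℕ) → (ι → Fin (k i)) → Set (ι → ℝ) := fun i j =>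
    {x | ∀ c, x c ∈ Icc (m c + (j c : ℕ) * r i) (m c + (j c : ℕ) * r i + r i)}
  have hk : ∀ i, (k i : ℝ≥0) * r i ≤ l + 2 * δ := fun i => by
    have h0 : (0 : ℝ) < r i := hr0 i
    have : (⌊(l : ℝ) / r i⌋₊ : ℝ) * r i ≤ l := by
      rw [← le_div_iff₀ h0]; exact Nat.floor_le (by positivity)
    have h2 : (r i : ℝ) ≤ 2 * δ := by exact_mod_cast hrδ i
    rw [← NNReal.coe_le_coe]
    simp only [k]
    push_cast
    linarith
  have hcube : ∀ i j, ediam (cube i j) ≤ r i := fun i j => by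
    refine ediam_le fun x hx y hy => ?_
    rw [edist_pi_le_iff]
    intro c
    rw [edist_nndist, ENNReal.coe_le_coe, ← NNReal.coe_le_coe, coe_nndist, Real.dist_eq, abs_le]
    have h1 := hx c; have h2 := hy c
    simp only [mem_Icc] at h1 h2
    constructor <;> linarith
  have hpiece : ∀ i j, ediam (cube i j ×ˢ t i) ≤ r i := fun i j => by
    refine ediam_le fun x hx y hy => ?_
    rw [Prod.edist_eq]
    exact max_le ((edist_le_ediam_of_mem hx.1 hy.1).trans (hcube i j))
      ((edist_le_ediam_of_mem hx.2 hy.2).trans (hrd i))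
  refine ⟨Σ i : {i : ℕ // (t i).Nonempty}, (ι → Fin (k i)), inferInstance,
    fun j => cube j.1 j.2 ×ˢ t j.1, ?_, ?_, ?_⟩
  · rintro ⟨x, y⟩ ⟨hx, hy⟩
    obtain ⟨i, hi⟩ := mem_iUnion.1 (ht hy)
    have h0 : (0 : ℝ) < r i := hr0 i
    refine mem_iUnion.2 ⟨⟨⟨i, y, hi⟩, fun c => ⟨⌊(x c - m c) / r i⌋₊, ?_⟩⟩, fun c => ?_, hi⟩
    · exact Nat.lt_succ_of_le (Nat.floor_le_floor (by gcongr; exact hm2 x hx c))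
    · have hpos : 0 ≤ (x c - m c) / r i := div_nonneg (by linarith [hm1 x hx c]) h0.le
      have h1 := Nat.floor_le hpos
      have h2 := (Nat.lt_floor_add_one ((x c - m c) / r i)).le
      rw [le_div_iff₀ h0] at h1
      rw [div_le_iff₀ h0] at h2
      simp only [mem_Icc]
      constructor <;> nlinarith
  · rintro ⟨i, j⟩
    exact (hpiece i j).trans (by exact_mod_cast hrδ i)
  · refine (ENNReal.tsum_sigma (fun (i : {i : ℕ // (t i).Nonempty}) (j : ι → Fin (k i)) =>
      ediam (cube i j ×ˢ t i) ^ (Fintype.card ι + q))).trans_le ?_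
    have hd : (0 : ℝ) ≤ Fintype.card ι := by positivity
    have h1 : ∀ i : {i : ℕ // (t i).Nonempty},
        ∑' j : ι → Fin (k i), ediam (cube i j ×ˢ t i) ^ (Fintype.card ι + q) ≤
          ((l + 2 * δ : ℝ≥0) : ℝ≥0∞) ^ Fintype.card ι * (ediam (t i) ^ q + ε i) := fun i => by
      have h2 : ∀ j : ι → Fin (k i), ediam (cube i j ×ˢ t i) ^ (Fintype.card ι + q) ≤
          (r i : ℝ≥0∞) ^ Fintype.card ι * (ediam (t i) ^ q + ε i) := fun j => by
        refine (ENNReal.rpow_le_rpow (hpiece i j) (add_nonneg hd hq)).trans ?_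
        rw [ENNReal.rpow_add_of_nonneg _ _ hd hq, ENNReal.rpow_natCast]
        gcongr
        exact hrq i
      refine (ENNReal.tsum_le_tsum h2).trans ?_
      rw [tsum_fintype, Finset.sum_const, Finset.card_univ, Fintype.card_fun, Fintype.card_fin,
        nsmul_eq_mul, ← mul_assoc]
      gcongr
      have := hk i
      rw [Nat.cast_pow, ← mul_pow]
      gcongr
      exact_mod_cast this
    refine (ENNReal.tsum_le_tsum h1).trans ?_
    rw [ENNReal.tsum_mul_left]
    gcongr
    rw [ENNReal.tsum_add]
    gcongr
    · refine le_trans ?_ hts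
      refine le_trans (ENNReal.tsum_le_tsum fun i => ?_)
        (ENNReal.tsum_comp_le_tsum_of_injective (f := fun i : {i : ℕ // (t i).Nonempty} => (i : ℕ))
          Subtype.val_injective (fun i => ⨆ _ : (t i).Nonempty, ediam (t i) ^ q))
      exact le_iSup_of_le i.2 le_rfl
    · exact (ENNReal.tsum_comp_le_tsum_of_injective (f := fun i : {i : ℕ // (t i).Nonempty} =>
        (i : ℕ)) Subtype.val_injective (fun i => (ε i : ℝ≥0∞))).trans hεs.le

theorem hausdorffMeasure_prod_le_ediam_pow {ι : Type} [Fintype ι] {q : ℝ} (hq : 0 ≤ q)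
    {S : Set (ι → ℝ)} (hS : ediam S ≠ ⊤) {T : Set Y} (hT : μH[q] T ≠ ⊤) :
    μH[Fintype.card ι + q] (S ×ˢ T) ≤ ediam S ^ Fintype.card ι * μH[q] T := by
  lift ediam S to ℝ≥0 using hS with l hl
  set δ : ℕ → ℝ≥0 := fun n => ((n : ℝ≥0) + 1)⁻¹ with hδdef
  have hδ : ∀ n, 0 < δ n := fun n => by positivity
  have hδt : Tendsto δ atTop (𝓝 0) := by
    have := (tendsto_add_atTop_iff_nat 1).2 (tendsto_inv_atTop_nhds_zero_nat (𝕜 := ℝ≥0))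
    simpa [hδdef] using this
  choose J hJ s hs hsd hss using fun n => exists_cover_prod_of_ediam_le hq hl.ge hT (hδ n)
  refine (hausdorffMeasure_le_liminf_tsum (ι := J) _ _ (fun n => ((2 * δ n : ℝ≥0) : ℝ≥0∞))
    (l := atTop) ?_ s (.of_forall hsd) (.of_forall hs)).trans ?_
  · rw [← ENNReal.coe_zero, ENNReal.tendsto_coe]
    simpa using hδt.const_mul 2
  · refine (liminf_le_liminf (.of_forall hss)).trans (le_of_eq ?_)
    refine Tendsto.liminf_eq ?_
    have h1 : Tendsto (fun n => ((l + 2 * δ n : ℝ≥0) : ℝ≥0∞) ^ Fintype.card ι) atTop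
        (𝓝 ((l : ℝ≥0∞) ^ Fintype.card ι)) := by
      refine ENNReal.Tendsto.pow ?_
      rw [ENNReal.tendsto_coe]
      simpa using (hδt.const_mul 2).const_add l
    have h2 : Tendsto (fun n => μH[q] T + δ n + δ n) atTop (𝓝 (μH[q] T)) := by
      have h3 : Tendsto (fun n => (δ n : ℝ≥0∞)) atTop (𝓝 0) := by
        rw [← ENNReal.coe_zero, ENNReal.tendsto_coe]; exact hδt
      simpa using (h3.const_add (μH[q] T)).add h3
    exact ENNReal.Tendsto.mul h1 (Or.inr hT) h2
      (Or.inr (ENNReal.pow_ne_top ENNReal.coe_ne_top))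

/-- As a function of S the left side is a measure bounded by a multiple of the power of the
diameter. `mkMetric` is the largest such measure, and for the sup metric on ℝ^d it is Lebesgue
measure, so the constant is one. -/
theorem hausdorffMeasure_prod_le_volume {ι : Type} [Fintype ι] {q : ℝ} (hq : 0 ≤ q)
    (S : Set (ι → ℝ)) {T : Set Y} (hT : μH[q] T ≠ ⊤) :
    μH[Fintype.card ι + q] (S ×ˢ T) ≤ volume S * μH[q] T := by
  -- The gauge below can only be rescaled by a nonzero factor, so a null T is treated separately, by
  -- exhausting the first factor with balls.
  by_cases h0 : μH[q] T = 0
  · refine le_of_eq_of_le ?_ zero_le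
    refine measure_mono_null (t := ⋃ n : ℕ, ball (0 : ι → ℝ) n ×ˢ T) ?_
      (measure_iUnion_null fun n => ?_)
    · rintro ⟨x, y⟩ ⟨-, hy⟩
      obtain ⟨n, hn⟩ := exists_nat_gt (dist x 0)
      exact mem_iUnion.2 ⟨n, hn, hy⟩
    · refine le_antisymm ?_ zero_le
      have hb : ediam (ball (0 : ι → ℝ) n) ≠ ⊤ := isBounded_ball.ediam_ne_top
      have := hausdorffMeasure_prod_le_ediam_pow hq hb hT
      rwa [h0, mul_zero] at this
  set n : Measure (ι → ℝ) := (μH[Fintype.card ι + q].restrict (univ ×ˢ T)).map Prod.fst with hn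
  have hnS : ∀ S, MeasurableSet S → n S = μH[Fintype.card ι + q] (S ×ˢ T) := fun S hS => by
    rw [hn, map_apply measurable_fst hS, restrict_apply (measurable_fst hS)]
    congr 1; ext ⟨x, y⟩; simp
  have hle : n ≤ (μH[q] T) • volume := by
    rw [← hausdorffMeasure_pi_real]
    have h1 : n ≤ mkMetric (μH[q] T • fun r : ℝ≥0∞ => r ^ (Fintype.card ι : ℝ)) := by
      refine le_mkMetric _ _ 1 one_pos fun s hs => ?_
      calc n s ≤ n (closure s) := measure_mono subset_closure
        _ ≤ ediam (closure s) ^ Fintype.card ι * μH[q] T := by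
          rw [hnS _ isClosed_closure.measurableSet]
          refine hausdorffMeasure_prod_le_ediam_pow hq ?_ hT
          rw [ediam_closure]
          exact ne_top_of_le_ne_top ENNReal.one_ne_top hs
        _ = _ := by simp [ediam_closure, mul_comm]
    refine h1.trans (mkMetric_mono_smul hT h0 ?_)
    exact .of_forall fun _ => le_rfl
  calc μH[Fintype.card ι + q] (S ×ˢ T)
      ≤ μH[Fintype.card ι + q] (toMeasurable volume S ×ˢ T) :=
        measure_mono (prod_mono_left (subset_toMeasurable _ _))
    _ = n (toMeasurable volume S) := (hnS _ (measurableSet_toMeasurable _ _)).symm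
    _ ≤ (μH[q] T • volume) (toMeasurable volume S) := hle _
    _ = _ := by simp [measure_toMeasurable, mul_comm]

theorem hausdorffMeasure_prod_image_le {X' : Type*} [MetricSpace X'] [SecondCountableTopology X']
    [MeasurableSpace X'] [BorelSpace X'] {f : X → X'} {S : Set X} {K : ℝ≥0}
    (hf : LipschitzOnWith K f S) (T : Set Y) {d : ℝ} (hd : 0 ≤ d) :
    μH[d] ((f '' S) ×ˢ T) ≤ (max K 1 : ℝ≥0) ^ d * μH[d] (S ×ˢ T) := by
  have h : LipschitzOnWith (max K 1) (Prod.map f id) (S ×ˢ T) := by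
    rintro ⟨x, y⟩ ⟨hx, hy⟩ ⟨x', y'⟩ ⟨hx', hy'⟩
    simp only [Prod.map, id, Prod.edist_eq]
    refine max_le ((hf hx hx').trans ?_) ?_
    · gcongr
      · exact le_max_left _ _
      · exact le_max_left _ _
    · calc edist y y' ≤ 1 * max (edist x x') (edist y y') := by simp
        _ ≤ _ := by
          gcongr
          exact_mod_cast le_max_right _ _
  have := h.hausdorffMeasure_image_le hd
  rwa [prodMap_image_prod, image_id] at this

theorem exists_hausdorffMeasure_prod_le_haar {F : Type*} [NormedAddCommGroup F] [NormedSpace ℝ F]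
    [FiniteDimensional ℝ F] [MeasurableSpace F] [BorelSpace F] (ν : Measure F) [ν.IsAddHaarMeasure]
    {q : ℝ} (hq : 0 ≤ q) : ∃ C : ℝ≥0, ∀ (S : Set F) (T : Set Y), μH[q] T ≠ ⊤ →
      μH[Module.finrank ℝ F + q] (S ×ˢ T) ≤ C * ν S * μH[q] T := by
  let L : F ≃L[ℝ] (Fin (Module.finrank ℝ F) → ℝ) :=
    ContinuousLinearEquiv.ofFinrankEq (by simp)
  have : (volume.map L.symm).IsAddHaarMeasure := L.symm.isAddHaarMeasure_map volume
  set c := addHaarScalarFactor (volume.map L.symm) ν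
  have hc : volume.map L.symm = c • ν := isAddLeftInvariant_eq_smul _ _
  set K := ‖(L.symm : (Fin (Module.finrank ℝ F) → ℝ) →L[ℝ] F)‖₊
  have hd : (0 : ℝ) ≤ Module.finrank ℝ F + q := by positivity
  refine ⟨(max K 1 : ℝ≥0) ^ (Module.finrank ℝ F + q) * c, fun S T hT => ?_⟩
  have h1 : S = L.symm '' (L '' S) := by simp [image_image]
  have h2 : volume (L '' S) = c * ν S := by
    have := congr($hc S)
    change volume.map L.symm.toHomeomorph.toMeasurableEquiv S = _ at this
    rw [MeasurableEquiv.map_apply] at this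
    rw [ContinuousLinearEquiv.image_eq_preimage_symm]
    exact this
  calc μH[Module.finrank ℝ F + q] (S ×ˢ T)
      = μH[Module.finrank ℝ F + q] ((L.symm '' (L '' S)) ×ˢ T) := by rw [← h1]
    _ ≤ (max K 1 : ℝ≥0) ^ (Module.finrank ℝ F + q) *
        μH[Module.finrank ℝ F + q] ((L '' S) ×ˢ T) :=
      hausdorffMeasure_prod_image_le (L.symm.lipschitz.lipschitzOnWith) T hd
    _ ≤ (max K 1 : ℝ≥0) ^ (Module.finrank ℝ F + q) * (c * ν S * μH[q] T) := by
      gcongr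
      have := hausdorffMeasure_prod_le_volume hq (L '' S) hT
      rwa [Fintype.card_fin, h2] at this
    _ = _ := by
      rw [ENNReal.coe_mul, ENNReal.coe_rpow_of_nonneg _ hd]; ring

/-- An outer measure that is bounded on boxes by a product measure is bounded by it. -/
theorem OuterMeasure.le_smul_pi {ι : Type*} [Fintype ι] {α : ι → Type*}
    [∀ i, MeasurableSpace (α i)] {m : ∀ i, Measure (α i)} {n : OuterMeasure (∀ i, α i)} {c : ℝ≥0∞}
    (hc : c ≠ ⊤) (h : ∀ s : ∀ i, Set (α i), n (univ.pi s) ≤ c * ∏ i, m i (s i))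
    (E : Set (∀ i, α i)) : n E ≤ c * Measure.pi m E := by
  -- The product outer measure is the largest one below the box content. No measurability of n or of
  -- the boxes enters.
  have h1 : n ≤ c • OuterMeasure.pi fun i => (m i).toOuterMeasure := by
    rw [OuterMeasure.pi, OuterMeasure.smul_boundedBy hc, OuterMeasure.le_boundedBy']
    exact fun s _ => le_trans (n.mono (subset_pi_eval_image univ s)) (h _)
  refine (h1 E).trans (mul_le_mul_right (b := OuterMeasure.pi _ E) ?_ c)
  rw [Measure.pi]
  exact le_toMeasure_apply _ _ _

/-- An outer measure that is bounded on rectangles by a product measure is bounded by it. -/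
theorem OuterMeasure.le_smul_prod.{u} {X Y : Type u} [mX : MeasurableSpace X]
    [mY : MeasurableSpace Y] {μ : Measure X} {ν : Measure Y} [SigmaFinite μ] [SigmaFinite ν]
    {n : OuterMeasure (X × Y)} {c : ℝ≥0∞} (hc : c ≠ ⊤)
    (h : ∀ S T, n (S ×ˢ T) ≤ c * (μ S * ν T)) (E : Set (X × Y)) :
    n E ≤ c * μ.prod ν E := by
  -- A pair is treated as a function on `Fin 2`, which is why both factors live in one universe.
  let α : Fin 2 → Type u := Fin.cons X fun _ => Y
  let mα : ∀ i, MeasurableSpace (α i) := Fin.cons mX fun _ => mY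
  let m : ∀ i, Measure (α i) := Fin.cons μ fun _ => ν
  have : ∀ i, SigmaFinite (m i) := fun i => by
    fin_cases i
    · exact inferInstanceAs (SigmaFinite μ)
    · exact inferInstanceAs (SigmaFinite ν)
  let E' : Set (α 0 × α 1) := E
  let n₀ : OuterMeasure (α 0 × α 1) := n
  have hmp : MeasurePreserving (MeasurableEquiv.piFinTwo α) (Measure.pi m) ((m 0).prod (m 1)) :=
    measurePreserving_piFinTwo m
  let n' : OuterMeasure (∀ i, α i) := OuterMeasure.comap (MeasurableEquiv.piFinTwo α) n₀
  have h2 := OuterMeasure.le_smul_pi (m := m) (n := n') hc (fun s => ?_)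
    ((MeasurableEquiv.piFinTwo α) ⁻¹' E')
  · rw [hmp.measure_preimage_equiv] at h2
    simp only [n', OuterMeasure.comap_apply] at h2
    rw [image_preimage_eq _ (MeasurableEquiv.piFinTwo α).surjective] at h2
    exact h2
  · simp only [n', OuterMeasure.comap_apply]
    refine le_trans (n₀.mono ?_) (h (s 0) (s 1)) |>.trans ?_
    · rintro _ ⟨x, hx, rfl⟩
      exact ⟨hx 0 trivial, hx 1 trivial⟩
    · rw [Fin.prod_univ_two]; exact le_rfl

/-- If the `p`-dimensional Hausdorff measure is σ-finite on a product set `G × T`, where `ν` is a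
measure of dimension `a` charging `G`, then there it has the null sets of the product of `ν` with
the `(p - a)`-dimensional Hausdorff measure. -/
theorem hausdorffMeasure_restrict_prod_mutuallyAC.{u} {X Y : Type u} [MetricSpace X]
    [SecondCountableTopology X] [MeasurableSpace X] [BorelSpace X] [MetricSpace Y]
    [SecondCountableTopology Y] [MeasurableSpace Y] [BorelSpace Y] {ν : Measure X} [SigmaFinite ν]
    {a : ℝ} (ha : 0 ≤ a) {𝒰 : Set (Set X)} (h𝒰 : 𝒰.Countable) (hcov : ⋃₀ 𝒰 = univ)
    (hgrowth : ∀ U ∈ 𝒰, ∃ C : ℝ≥0, ∀ S ⊆ U, ν S ≤ C * ediam S ^ a)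
    (hprod : ∀ U ∈ 𝒰, ∀ q : ℝ, 0 ≤ q → ∃ C : ℝ≥0, ∀ S ⊆ U, ∀ T : Set Y, μH[q] T ≠ ⊤ →
      μH[a + q] (S ×ˢ T) ≤ C * ν S * μH[q] T)
    {G : Set X} (hG : MeasurableSet G) (hG0 : ν G ≠ 0) {T : Set Y} (hT : MeasurableSet T)
    (hT0 : T.Nonempty) {p : ℝ} {s : ℕ → Set (X × Y)} (hs : G ×ˢ T ⊆ ⋃ n, s n)
    (hsf : ∀ n, μH[p] (s n) ≠ ⊤) :
    a ≤ p ∧ SigmaFinite ((μH[p - a] : Measure Y).restrict T) ∧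
      MutuallyAC (μH[p].restrict (G ×ˢ T)) ((ν.restrict G).prod (μH[p - a].restrict T)) := by
  have hcov' : ∀ A : Set X, A = ⋃ U ∈ 𝒰, A ∩ U := fun A => by
    rw [← inter_iUnion₂, ← sUnion_eq_biUnion, hcov, inter_univ]
  have hnull : ∀ A : Set X, (∀ U ∈ 𝒰, ν (A ∩ U) = 0) → ν A = 0 := fun A h => by
    rw [hcov' A]; exact (measure_biUnion_null_iff h𝒰).2 h
  -- If p < a, then G × {y} is null in dimension a. Eilenberg's inequality with q = 0 counts points
  -- of slices, so ν-almost no x could lie in G.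
  have hap : a ≤ p := by
    by_contra! hlt
    obtain ⟨y, hy⟩ := hT0
    have h0 : μH[a] (G ×ˢ ({y} : Set Y)) = 0 := by
      refine measure_mono_null (t := ⋃ n, s n) ((Set.prod_mono_right (by simpa using hy)).trans hs)
        (measure_iUnion_null fun n => ?_)
      exact (hausdorffMeasure_zero_or_top hlt (s n)).resolve_right (hsf n)
    refine hG0 (hnull G fun U hU => ?_)
    obtain ⟨C, hC⟩ := hgrowth U hU
    have h1 : μH[a + 0] ((G ∩ U) ×ˢ ({y} : Set Y)) = 0 := by
      rw [add_zero]; exact measure_mono_null (prod_mono_left inter_subset_left) h0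
    obtain ⟨g, hgm, hg, hgi⟩ := exists_lintegral_hausdorffMeasure_slice_le ha le_rfl hC
      (E := (G ∩ U) ×ˢ ({y} : Set Y)) (prod_mono inter_subset_right (subset_univ _)) (by rw [h1]; simp)
    rw [h1, mul_zero, nonpos_iff_eq_zero, lintegral_eq_zero_iff hgm] at hgi
    refine measure_mono_null (fun x hx => ?_) hgi
    have h2 : {z | (x, z) ∈ (G ∩ U) ×ˢ ({y} : Set Y)} = {y} := by ext z; simp [hx.1, hx.2]
    have h3 := hg x
    rw [h2, hausdorffMeasure_zero_singleton] at h3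
    exact fun h => by rw [h] at h3; simp at h3
  set q := p - a with hq
  have hq0 : 0 ≤ q := by linarith
  have hpq : p = a + q := by rw [hq]; ring
  -- By Eilenberg's inequality almost every slice of each s n has finite q-measure. The slices
  -- through one good x ∈ G cover T.
  have hsfin : SigmaFinite ((μH[q] : Measure Y).restrict T) := by
    obtain ⟨U, hU, hGU⟩ : ∃ U ∈ 𝒰, ν (G ∩ U) ≠ 0 := by
      by_contra! h
      exact hG0 (hnull G h)
    obtain ⟨C, hC⟩ := hgrowth U hU
    have hfin : ∀ n, μH[a + q] (s n ∩ (G ∩ U) ×ˢ T) ≠ ⊤ := fun n => by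
      rw [← hpq]
      exact ne_top_of_le_ne_top (hsf n) (measure_mono inter_subset_left)
    choose g hgm hg hgi using fun n => exists_lintegral_hausdorffMeasure_slice_le ha hq0 hC
      (E := s n ∩ (G ∩ U) ×ˢ T)
      (fun z hz => ⟨hz.2.1.2, trivial⟩) (hfin n)
    have hae : ∀ᵐ x ∂ν, ∀ n, g n x < ⊤ := ae_all_iff.2 fun n =>
      ae_lt_top (hgm n) (ne_top_of_le_ne_top (ENNReal.mul_ne_top ENNReal.coe_ne_top (hfin n))
        (hgi n))
    obtain ⟨x, hxG, hx⟩ : ∃ x ∈ G ∩ U, ∀ n, g n x < ⊤ := by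
      by_contra! h
      refine hGU (measure_mono_null (t := {x | ¬ ∀ n, g n x < ⊤}) (fun x hx hx' => ?_) hae)
      obtain ⟨n, hn⟩ := h x hx
      exact absurd (hx' n) (not_lt.2 hn)
    refine ⟨⟨⟨fun n => {y | (x, y) ∈ s n ∩ (G ∩ U) ×ˢ T} ∪ Tᶜ, fun _ => trivial, fun n => ?_, ?_⟩⟩⟩
    · rw [restrict_apply' hT]
      refine lt_of_le_of_lt (measure_mono ?_) ((hg n x).trans_lt (hx n))
      rintro y ⟨hy | hy, hy'⟩
      · exact hy
      · exact absurd hy' hy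
    · refine eq_univ_of_forall fun y => ?_
      by_cases hy : y ∈ T
      · obtain ⟨n, hn⟩ := mem_iUnion.1 (hs (show (x, y) ∈ G ×ˢ T from ⟨hxG.1, hy⟩))
        exact mem_iUnion.2 ⟨n, Or.inl ⟨hn, hxG, hy⟩⟩
      · exact mem_iUnion.2 ⟨0, Or.inr hy⟩
  refine ⟨hap, hsfin, ?_, ?_⟩
  · intro E hE
    set τ : Measure Y := μH[q].restrict T with hτ
    have hτ' : ∀ A, τ A = μH[q] (A ∩ T) := fun A => restrict_apply' hT
    rw [restrict_apply' (hG.prod hT)]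
    refine measure_mono_null (t := ⋃ U ∈ 𝒰, ⋃ n, E ∩ ((G ∩ U) ×ˢ (T ∩ spanningSets τ n))) ?_
      ((measure_biUnion_null_iff h𝒰).2 fun U hU => measure_iUnion_null fun n => ?_)
    · rintro ⟨x, y⟩ ⟨hE, hx, hy⟩
      obtain ⟨U, hU, hxU⟩ := mem_sUnion.1 (hcov.symm ▸ mem_univ x)
      obtain ⟨n, hn⟩ := mem_iUnion.1 ((iUnion_spanningSets τ).symm ▸ mem_univ y)
      exact mem_iUnion₂.2 ⟨U, hU, mem_iUnion.2 ⟨n, hE, ⟨hx, hxU⟩, hy, hn⟩⟩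
    -- The rectangle bound extends to all subsets of R as a bound by the product measure; the
    -- spanning sets keep the second factors finite, as `hprod` requires.
    · obtain ⟨C, hC⟩ := hprod U hU q hq0
      set R := (G ∩ U) ×ˢ (T ∩ spanningSets τ n) with hR
      have hle := OuterMeasure.le_smul_prod (μ := ν.restrict G) (ν := τ)
        (n := OuterMeasure.restrict R (μH[p] : Measure (X × Y)).toOuterMeasure)
        (c := C) ENNReal.coe_ne_top (fun S S' => ?_) E
      · rw [hE, mul_zero] at hle
        simpa using hle
      · rw [OuterMeasure.restrict_apply, hR, prod_inter_prod]
        have hfin : μH[q] (S' ∩ (T ∩ spanningSets τ n)) ≠ ⊤ := by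
          have := measure_spanningSets_lt_top τ n
          rw [hτ', inter_comm] at this
          exact ne_top_of_le_ne_top this.ne (measure_mono inter_subset_right)
        have h1 := hC (S ∩ (G ∩ U)) (fun x hx => hx.2.2) _ hfin
        rw [← hpq] at h1
        refine h1.trans ?_
        rw [mul_assoc, hτ', restrict_apply' hG]
        gcongr
        · exact inter_subset_left
        · exact inter_subset_left
  · refine AbsolutelyContinuous.mk fun E hE hE0 => ?_
    rw [restrict_apply hE] at hE0
    rw [measure_prod_null hE]
    -- Eilenberg's inequality applied to a null set: its slices are null for ν-almost every x.
    have hae : ∀ᵐ x ∂ν, ∀ U ∈ 𝒰, μH[q] {y | (x, y) ∈ E ∩ (G ∩ U) ×ˢ T} = 0 := by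
      rw [ae_ball_iff h𝒰]
      intro U hU
      obtain ⟨C, hC⟩ := hgrowth U hU
      have h0 : μH[a + q] (E ∩ (G ∩ U) ×ˢ T) = 0 := by
        rw [← hpq]
        exact measure_mono_null (inter_subset_inter_right _ (prod_mono_left inter_subset_left)) hE0
      obtain ⟨g, hgm, hg, hgi⟩ := exists_lintegral_hausdorffMeasure_slice_le ha hq0 hC
        (E := E ∩ (G ∩ U) ×ˢ T) (fun z hz => ⟨hz.2.1.2, trivial⟩) (by simp [h0])
      rw [h0, mul_zero, nonpos_iff_eq_zero, lintegral_eq_zero_iff hgm] at hgi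
      filter_upwards [hgi] with x hx
      exact le_antisymm ((hg x).trans hx.le) zero_le
    refine (ae_restrict_iff' hG).2 ?_
    filter_upwards [hae] with x hx hxG
    obtain ⟨U, hU, hxU⟩ := mem_sUnion.1 (hcov.symm ▸ mem_univ x)
    rw [Pi.zero_apply, restrict_apply' hT]
    refine measure_mono_null (fun y hy => ?_) (hx U hU)
    exact ⟨hy.1, ⟨hxG, hxU⟩, hy.2⟩

end HausdorffProduct

/-! ### Charts of a Riemannian manifold are locally bi-Lipschitz. -/

section RiemannianChart
open Filter Topology Metric
open scoped NNReal

variable {E : Type*} [NormedAddCommGroup E] [NormedSpace ℝ E]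
  {M : Type*} [MetricSpace M] [ChartedSpace E M]
  [Bundle.RiemannianBundle (fun x : M => TangentSpace 𝓘(ℝ, E) x)]
  [IsManifold 𝓘(ℝ, E) 1 M] [IsContinuousRiemannianBundle E (fun x : M => TangentSpace 𝓘(ℝ, E) x)]
  [IsRiemannianManifold 𝓘(ℝ, E) M]

attribute [local instance] normedAddCommGroupTangentSpaceVectorSpace
attribute [local instance] normedSpaceTangentSpaceVectorSpace

/-- The inverse chart has bounded derivative on a small ball. That ball is convex, so the image of a
segment is an admissible curve whose length is at most C times that of the segment. -/
theorem eventually_lipschitz_extChartAt_symm (x : M) :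
    ∃ C : ℝ≥0, ∃ U ∈ 𝓝 x, ∀ y ∈ U, ∀ z ∈ U,
      edist y z ≤ C * edist (extChartAt 𝓘(ℝ, E) x y) (extChartAt 𝓘(ℝ, E) x z) := by
  rcases eventually_enorm_mfderivWithin_symm_extChartAt_lt 𝓘(ℝ, E) x with ⟨C, C_pos, hC⟩
  have hC' := inter_mem (extChartAt_target_mem_nhdsWithin (I := 𝓘(ℝ, E)) x) hC
  rw [ModelWithCorners.range_eq_univ, nhdsWithin_univ] at hC'
  obtain ⟨r, r_pos, hr⟩ := Metric.mem_nhds_iff.1 hC'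
  have A : (extChartAt 𝓘(ℝ, E) x) ⁻¹' ball (extChartAt 𝓘(ℝ, E) x x) r ∈ 𝓝 x :=
    (continuousAt_extChartAt x).preimage_mem_nhds (ball_mem_nhds _ r_pos)
  refine ⟨C, _, inter_mem A (chart_source_mem_nhds E x), ?_⟩
  rintro y ⟨hy, h'y⟩ z ⟨hz, h'z⟩
  let η := ContinuousAffineMap.lineMap (R := ℝ) (extChartAt 𝓘(ℝ, E) x y) (extChartAt 𝓘(ℝ, E) x z)
  set γ := (extChartAt 𝓘(ℝ, E) x).symm ∘ η with hγ
  have hη0 : ∀ t ∈ Icc (0 : ℝ) 1, η t ∈ ball (extChartAt 𝓘(ℝ, E) x x) r := by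
    intro t ht
    apply (convex_ball (extChartAt 𝓘(ℝ, E) x x) r).segment_subset hy hz
    rw [segment_eq_image_lineMap]
    exact ⟨t, ht, by simp [η, ContinuousAffineMap.coe_lineMap_eq]⟩
  have hη := fun t ht => hr (hη0 t ht)
  have η_smooth : ContMDiffOn 𝓘(ℝ, ℝ) 𝓘(ℝ, E) 1 η (Icc 0 1) := by
    apply ContMDiff.contMDiffOn
    rw [contMDiff_iff_contDiff]
    exact ContinuousAffineMap.contDiff _
  rw [IsRiemannianManifold.out (I := 𝓘(ℝ, E)) y z]
  have : riemannianEDist 𝓘(ℝ, E) y z ≤ pathELength 𝓘(ℝ, E) γ 0 1 := by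
    apply riemannianEDist_le_pathELength _ _ _ zero_le_one
    · exact (contMDiffOn_extChartAt_symm x).comp η_smooth fun t ht => (hη t ht).1
    · simp [γ, η, ContinuousAffineMap.coe_lineMap_eq, h'y]
    · simp [γ, η, ContinuousAffineMap.coe_lineMap_eq, h'z]
  apply this.trans
  rw [← lintegral_fderiv_lineMap_eq_edist, pathELength_eq_lintegral_mfderivWithin_Icc,
    ← lintegral_const_mul' _ _ ENNReal.coe_ne_top]
  apply setLIntegral_mono' measurableSet_Icc (fun t ht ↦ ?_)
  have : mfderivWithin 𝓘(ℝ, ℝ) 𝓘(ℝ, E) γ (Icc 0 1) t =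
      (mfderivWithin 𝓘(ℝ, E) 𝓘(ℝ, E) (extChartAt 𝓘(ℝ, E) x).symm univ (η t)) ∘L
        (mfderivWithin 𝓘(ℝ, ℝ) 𝓘(ℝ, E) η (Icc 0 1) t) := by
    apply mfderivWithin_comp
    · have := mdifferentiableWithinAt_extChartAt_symm (I := 𝓘(ℝ, E)) (hη t ht).1
      rwa [ModelWithCorners.range_eq_univ] at this
    · exact η_smooth.mdifferentiableOn one_ne_zero t ht
    · exact fun _ _ => trivial
    · rw [uniqueMDiffWithinAt_iff_uniqueDiffWithinAt]
      exact uniqueDiffOn_Icc zero_lt_one t ht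
  have : mfderivWithin 𝓘(ℝ, ℝ) 𝓘(ℝ, E) γ (Icc 0 1) t 1 =
      (mfderivWithin 𝓘(ℝ, E) 𝓘(ℝ, E) (extChartAt 𝓘(ℝ, E) x).symm univ (η t))
        (mfderivWithin 𝓘(ℝ, ℝ) 𝓘(ℝ, E) η (Icc 0 1) t 1) := congr($this 1)
  rw [this]
  apply (ContinuousLinearMap.le_opENorm _ _).trans
  gcongr
  · exact (hη t ht).2.le
  · simp only [mfderivWithin_eq_fderivWithin]
    exact le_of_eq rfl

/-- The chart has bounded derivative near x, so it sends a nearly shortest curve from y to z to a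
curve of length at most C times as large. -/
theorem eventually_lipschitz_extChartAt (x : M) :
    ∃ C : ℝ≥0, ∃ U ∈ 𝓝 x, ∀ y ∈ U, ∀ z ∈ U,
      edist (extChartAt 𝓘(ℝ, E) x y) (extChartAt 𝓘(ℝ, E) x z) ≤ C * edist y z := by
  rcases eventually_enorm_mfderiv_extChartAt_lt 𝓘(ℝ, E) x with ⟨C, C_pos, hC⟩
  obtain ⟨r, r_pos, hr⟩ := EMetric.mem_nhds_iff.1
    (inter_mem hC (extChartAt_source_mem_nhds (I := 𝓘(ℝ, E)) x))
  -- A curve of length less than 2r/3 starting within r/3 of x stays in the ball of radius r, where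
  -- the derivative is controlled.
  refine ⟨C, _, Metric.eball_mem_nhds x (ε := r / 3) (by simpa using r_pos.ne'), ?_⟩
  intro y hy z hz
  have hyz : edist y z < r / 3 + r / 3 := by
    refine (edist_triangle_right y z x).trans_lt ?_
    exact ENNReal.add_lt_add hy hz
  have key : ∀ a : ℝ≥0∞, edist y z < a → a ≤ r / 3 + r / 3 →
      edist (extChartAt 𝓘(ℝ, E) x y) (extChartAt 𝓘(ℝ, E) x z) ≤ C * a := by
    intro a ha har
    rw [IsRiemannianManifold.out (I := 𝓘(ℝ, E)) y z] at ha
    obtain ⟨γ, hγ0, hγ1, γ_smooth, hγ, -⟩ :=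
      exists_lt_locally_constant_of_riemannianEDist_lt ha zero_lt_one
    have hmem : ∀ t ∈ Icc (0 : ℝ) 1, γ t ∈ Metric.eball x r := fun t ht => by
      have h1 : edist y (γ t) < a := by
        rw [IsRiemannianManifold.out (I := 𝓘(ℝ, E)) y (γ t)]
        refine (riemannianEDist_le_pathELength γ_smooth.contMDiffOn hγ0 rfl ht.1).trans_lt ?_
        exact (pathELength_mono le_rfl ht.2).trans_lt hγ
      rw [Metric.mem_eball]
      calc edist (γ t) x ≤ edist (γ t) y + edist y x := edist_triangle _ _ _
        _ < r / 3 + r / 3 + r / 3 := by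
          refine ENNReal.add_lt_add ?_ hy
          rw [edist_comm]; exact h1.trans_le har
        _ = r := ENNReal.add_thirds r
    let γ' := extChartAt 𝓘(ℝ, E) x ∘ γ
    have hsrc : ∀ t ∈ Icc (0 : ℝ) 1, γ t ∈ (chartAt E x).source := fun t ht => by
      have := (hr (hmem t ht)).2
      rwa [extChartAt_source] at this
    have hCM : ContMDiffOn 𝓘(ℝ, ℝ) 𝓘(ℝ, E) 1 γ' (Icc 0 1) :=
      contMDiffOn_extChartAt.comp (I' := 𝓘(ℝ, E)) (t := (chartAt E x).source)
        γ_smooth.contMDiffOn hsrc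
    calc edist (extChartAt 𝓘(ℝ, E) x y) (extChartAt 𝓘(ℝ, E) x z)
        = ‖γ' 1 - γ' 0‖ₑ := by
          rw [edist_comm, edist_eq_enorm_sub]; simp [γ', hγ0, hγ1]
    _ ≤ ∫⁻ t' in Icc 0 1, ‖derivWithin γ' (Icc 0 1) t'‖ₑ := by
      apply enorm_sub_le_lintegral_derivWithin_Icc_of_contDiffOn_Icc _ zero_le_one
      rwa [← contMDiffOn_iff_contDiffOn]
    _ ≤ ∫⁻ t' in Icc (0 : ℝ) 1, C * ‖mfderivWithin 𝓘(ℝ, ℝ) 𝓘(ℝ, E) γ (Icc 0 1) t' 1‖ₑ := by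
      apply setLIntegral_mono' measurableSet_Icc (fun t' ht' ↦ ?_)
      have h1 : mfderivWithin 𝓘(ℝ, ℝ) 𝓘(ℝ, E) γ' (Icc 0 1) t' =
          (mfderiv 𝓘(ℝ, E) 𝓘(ℝ, E) (extChartAt 𝓘(ℝ, E) x) (γ t')) ∘L
            (mfderivWithin 𝓘(ℝ, ℝ) 𝓘(ℝ, E) γ (Icc 0 1) t') := by
        apply mfderiv_comp_mfderivWithin
        · exact mdifferentiableAt_extChartAt (hsrc t' ht')
        · exact (γ_smooth.mdifferentiable one_ne_zero).mdifferentiableOn _ ht'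
        · rw [uniqueMDiffWithinAt_iff_uniqueDiffWithinAt]
          exact uniqueDiffOn_Icc zero_lt_one _ ht'
      have h2 : mfderivWithin 𝓘(ℝ, ℝ) 𝓘(ℝ, E) γ' (Icc 0 1) t' 1 =
          (mfderiv 𝓘(ℝ, E) 𝓘(ℝ, E) (extChartAt 𝓘(ℝ, E) x) (γ t'))
            (mfderivWithin 𝓘(ℝ, ℝ) 𝓘(ℝ, E) γ (Icc 0 1) t' 1) := congr($h1 1)
      have h3 : derivWithin γ' (Icc 0 1) t' =
          mfderivWithin 𝓘(ℝ, ℝ) 𝓘(ℝ, E) γ' (Icc 0 1) t' 1 := by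
        rw [mfderivWithin_eq_fderivWithin, ← fderivWithin_derivWithin]; rfl
      rw [h3, h2]
      apply (ContinuousLinearMap.le_opENorm _ _).trans
      gcongr
      exact (hr (hmem t' ht')).1.le
    _ = C * pathELength 𝓘(ℝ, E) γ 0 1 := by
      rw [lintegral_const_mul' _ _ ENNReal.coe_ne_top,
          pathELength_eq_lintegral_mfderivWithin_Icc]
    _ ≤ C * a := by gcongr
  rw [mul_comm, ← ENNReal.div_le_iff_le_mul (by simp [C_pos.ne']) (by simp)]
  refine le_of_forall_gt_imp_ge_of_dense fun a ha => ?_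
  rw [ENNReal.div_le_iff_le_mul (by simp [C_pos.ne']) (by simp), mul_comm]
  exact (key _ (lt_min ha hyz) (min_le_right _ _)).trans (by gcongr; exact min_le_left _ _)

end RiemannianChart

/-! ### Measures comparable to Lebesgue measure in charts. -/

section EuclideanCharts
open Filter Topology Metric Measure
open scoped NNReal

/-- `A` is covered by countably many sets of finite measure. -/
def IsSigmaFiniteOn {X : Type*} [MeasurableSpace X] (μ : Measure X) (A : Set X) : Prop :=
  ∃ s : ℕ → Set X, A ⊆ ⋃ n, s n ∧ ∀ n, μ (s n) ≠ ⊤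

theorem IsSigmaFiniteOn.mono {X : Type*} [MeasurableSpace X] {μ : Measure X} {A B : Set X}
    (h : IsSigmaFiniteOn μ B) (hAB : A ⊆ B) : IsSigmaFiniteOn μ A :=
  let ⟨s, hs, hf⟩ := h
  ⟨s, hAB.trans hs, hf⟩

theorem IsSigmaFiniteOn.of_measure_ne_top {X : Type*} [MeasurableSpace X] {μ : Measure X}
    {A : Set X} (h : μ A ≠ ⊤) : IsSigmaFiniteOn μ A :=
  ⟨fun _ => A, fun _ hx => mem_iUnion.2 ⟨0, hx⟩, fun _ => h⟩

theorem IsSigmaFiniteOn.biUnion {X ι : Type*} [MeasurableSpace X] {μ : Measure X} {I : Set ι}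
    (hI : I.Countable) {A : ι → Set X} (h : ∀ i ∈ I, IsSigmaFiniteOn μ (A i)) :
    IsSigmaFiniteOn μ (⋃ i ∈ I, A i) := by
  rcases I.eq_empty_or_nonempty with rfl | hne
  · exact ⟨fun _ => ∅, by simp, by simp⟩
  obtain ⟨e, rfl⟩ := hI.exists_eq_range hne
  choose s hs hf using fun n => h (e n) ⟨n, rfl⟩
  refine ⟨fun n => s n.unpair.1 n.unpair.2, ?_, fun n => hf _ _⟩
  simp only [mem_range, iUnion_exists, iUnion_iUnion_eq', iUnion_subset_iff]
  intro n x hx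
  obtain ⟨m, hm⟩ := mem_iUnion.1 (hs n hx)
  exact mem_iUnion.2 ⟨Nat.pair n m, by simpa using hm⟩

/-- Around every point there is a chart to `ℝ ^ d` with Lipschitz inverse under which `μ` is
comparable to Lebesgue measure, and `μ` grows at most like the `d`-th power of the diameter. -/
def HasEuclideanCharts {X : Type*} [MetricSpace X] [MeasurableSpace X] (μ : Measure X) (d : ℕ) :
    Prop :=
  ∀ x, ∃ U ∈ 𝓝 x, ∃ (φ : X → Fin d → ℝ) (C : ℝ≥0),
    (∀ y ∈ U, ∀ z ∈ U, edist y z ≤ C * edist (φ y) (φ z)) ∧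
    (∀ S ⊆ U, volume (φ '' S) ≤ C * μ S) ∧ ∀ S ⊆ U, μ S ≤ C * ediam S ^ d

variable {X : Type*} [MetricSpace X] [SecondCountableTopology X] [MeasurableSpace X]
  [BorelSpace X]

theorem HasEuclideanCharts.sigmaFinite {μ : Measure X} {d : ℕ} (h : HasEuclideanCharts μ d) :
    SigmaFinite μ := by
  have : IsLocallyFiniteMeasure μ := ⟨fun x => by
    obtain ⟨U, hU, φ, C, -, -, hC⟩ := h x
    refine ⟨U ∩ ball x 1, inter_mem hU (ball_mem_nhds x one_pos), ?_⟩
    refine (hC _ inter_subset_left).trans_lt ?_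
    have : ediam (U ∩ ball x 1) ≠ ⊤ := (isBounded_ball.subset inter_subset_right).ediam_ne_top
    exact ENNReal.mul_lt_top ENNReal.coe_lt_top (ENNReal.pow_lt_top this.lt_top)⟩
  infer_instance

/-- The powers of a measure with Euclidean charts satisfy the two hypotheses of
`hausdorffMeasure_restrict_prod_mutuallyAC`. -/
theorem HasEuclideanCharts.exists_cover_pi {μ : Measure X} {d : ℕ} (h : HasEuclideanCharts μ d)
    (m : ℕ) (Y : Type*) [MetricSpace Y] [SecondCountableTopology Y] [MeasurableSpace Y]
    [BorelSpace Y] :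
    ∃ 𝒰 : Set (Set (Fin m → X)), 𝒰.Countable ∧ ⋃₀ 𝒰 = univ ∧
      (∀ U ∈ 𝒰, ∃ C : ℝ≥0, ∀ S ⊆ U, (Measure.pi fun _ => μ) S ≤ C * ediam S ^ ((m * d : ℕ) : ℝ)) ∧
      ∀ U ∈ 𝒰, ∀ q : ℝ, 0 ≤ q → ∃ C : ℝ≥0, ∀ S ⊆ U, ∀ T : Set Y, μH[q] T ≠ ⊤ →
        μH[(m * d : ℕ) + q] (S ×ˢ T) ≤ C * (Measure.pi fun _ => μ) S * μH[q] T := by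
  have := h.sigmaFinite
  choose U hU φ C hφ hvol hgr using h
  obtain ⟨s, hs, hsU⟩ := TopologicalSpace.countable_cover_nhds
    (f := fun x : Fin m → X => univ.pi fun i => U (x i))
    (fun x => set_pi_mem_nhds finite_univ fun i _ => hU (x i))
  refine ⟨(fun x : Fin m → X => univ.pi fun i => U (x i)) '' s, hs.image _,
    by rw [sUnion_image]; exact hsU, ?_, ?_⟩
  · rintro _ ⟨x, -, rfl⟩
    refine ⟨∏ i, C (x i), fun S hS => ?_⟩
    calc (Measure.pi fun _ => μ) S
        ≤ (Measure.pi fun _ => μ) (univ.pi fun i => Function.eval i '' S) :=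
          measure_mono (subset_pi_eval_image _ _)
      _ = ∏ i, μ (Function.eval i '' S) := pi_pi _ _
      _ ≤ ∏ i : Fin m, C (x i) * ediam S ^ d := by
        refine Finset.prod_le_prod' fun i _ => ?_
        refine (hgr (x i) (Function.eval i '' S) ?_).trans ?_
        · rintro _ ⟨y, hy, rfl⟩
          exact hS hy i trivial
        · gcongr
          simpa using (LipschitzWith.eval i).ediam_image_le S
      _ = _ := by
        rw [Finset.prod_mul_distrib, Finset.prod_const, Finset.card_univ, Fintype.card_fin,
          ENNReal.rpow_natCast, ← pow_mul, mul_comm d]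
        push_cast; rfl
  · rintro _ ⟨x, -, rfl⟩ q hq
    set B : Set (Fin m → X) := univ.pi fun i => U (x i) with hB
    let Φ : (Fin m → X) → Fin m → Fin d → ℝ := fun y i => φ (x i) (y i)
    obtain ⟨C₀, hC₀⟩ := exists_hausdorffMeasure_prod_le_haar (Y := Y)
      (volume : Measure (Fin m → Fin d → ℝ)) hq
    have hfr : Module.finrank ℝ (Fin m → Fin d → ℝ) = m * d := by
      simp [Module.finrank_pi_fintype]
    rw [hfr] at hC₀
    set K : ℝ≥0 := ∑ i, C (x i)
    have hanti : ∀ y ∈ B, ∀ z ∈ B, edist y z ≤ K * edist (Φ y) (Φ z) := fun y hy z hz => by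
      rw [edist_pi_le_iff]
      intro i
      refine (hφ (x i) _ (hy i trivial) _ (hz i trivial)).trans ?_
      gcongr
      · exact Finset.single_le_sum (f := fun i => C (x i)) (fun _ _ => zero_le) (Finset.mem_univ i)
      · exact edist_le_pi_edist (Φ y) (Φ z) i
    -- The product chart acts coordinatewise, so the comparison holds on boxes. The outer measure
    -- bound carries it to arbitrary S.
    have hvolS : ∀ S ⊆ B, volume (Φ '' S) ≤ (∏ i, C (x i) : ℝ≥0) * (Measure.pi fun _ => μ) S := by
      intro S hS
      have := OuterMeasure.le_smul_pi (m := fun _ : Fin m => μ)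
        (n := OuterMeasure.restrict B (OuterMeasure.comap Φ volume.toOuterMeasure))
        (c := (∏ i, C (x i) : ℝ≥0)) ENNReal.coe_ne_top (fun t => ?_) S
      · simpa [inter_eq_self_of_subset_left hS] using this
      · simp only [OuterMeasure.restrict_apply, OuterMeasure.comap_apply]
        calc volume (Φ '' (univ.pi t ∩ B))
            ≤ volume (univ.pi fun i => φ (x i) '' (t i ∩ U (x i))) := by
              refine measure_mono ?_
              rintro _ ⟨y, ⟨hy, hyB⟩, rfl⟩ i -
              exact ⟨y i, ⟨hy i trivial, hyB i trivial⟩, rfl⟩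
          _ = ∏ i, volume (φ (x i) '' (t i ∩ U (x i))) := pi_pi _ _
          _ ≤ ∏ i, C (x i) * μ (t i) := by
            refine Finset.prod_le_prod' fun i _ => (hvol (x i) _ inter_subset_right).trans ?_
            gcongr
            exact inter_subset_left
          _ = _ := by rw [Finset.prod_mul_distrib]; push_cast; rfl
    have hd : (0 : ℝ) ≤ (m * d : ℕ) + q := by positivity
    -- The factors come from the Lipschitz inverse of the product chart, the product estimate in
    -- Euclidean space, and the volume comparison in each coordinate.
    refine ⟨(max K 1 : ℝ≥0) ^ ((m * d : ℕ) + q) * (C₀ * ∏ i, C (x i)), fun S hS T hT => ?_⟩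
    rcases S.eq_empty_or_nonempty with rfl | hne
    · simp
    have : Nonempty (Fin m → X) := ⟨hne.some⟩
    have hinj : InjOn Φ S := fun y hy z hz hyz => by
      have := hanti y (hS hy) z (hS hz)
      rwa [hyz, edist_self, mul_zero, nonpos_iff_eq_zero, edist_eq_zero] at this
    have hinv : ∀ y ∈ S, Function.invFunOn Φ S (Φ y) = y := hinj.leftInvOn_invFunOn
    have hlip : LipschitzOnWith K (Function.invFunOn Φ S) (Φ '' S) := by
      rintro _ ⟨y, hy, rfl⟩ _ ⟨z, hz, rfl⟩
      rw [hinv y hy, hinv z hz]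
      exact hanti y (hS hy) z (hS hz)
    have himg : Function.invFunOn Φ S '' (Φ '' S) = S := by
      rw [image_image]
      exact (image_congr hinv).trans (image_id' S)
    calc μH[(m * d : ℕ) + q] (S ×ˢ T)
        = μH[(m * d : ℕ) + q] ((Function.invFunOn Φ S '' (Φ '' S)) ×ˢ T) := by rw [himg]
      _ ≤ (max K 1 : ℝ≥0) ^ ((m * d : ℕ) + q) * μH[(m * d : ℕ) + q] ((Φ '' S) ×ˢ T) :=
        hausdorffMeasure_prod_image_le hlip T hd
      _ ≤ (max K 1 : ℝ≥0) ^ ((m * d : ℕ) + q) * (C₀ * ((∏ i, C (x i) : ℝ≥0) *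
          (Measure.pi fun _ => μ) S) * μH[q] T) := by
        gcongr
        refine (hC₀ _ T hT).trans ?_
        gcongr
        exact hvolS S hS
      _ = _ := by
        rw [ENNReal.coe_mul, ENNReal.coe_rpow_of_nonneg _ hd, ENNReal.coe_mul]; ring

end EuclideanCharts

/-! ### The Riemannian volume and the σ-finiteness of submanifold volumes. -/

section RiemannianVolume
open Filter Topology Metric Measure
open scoped NNReal

variable {E : Type*} [NormedAddCommGroup E] [NormedSpace ℝ E] [FiniteDimensional ℝ E]
  {M : Type*} [MetricSpace M] [ChartedSpace E M]
  [Bundle.RiemannianBundle (fun x : M => TangentSpace 𝓘(ℝ, E) x)]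
  [IsManifold 𝓘(ℝ, E) 1 M] [IsContinuousRiemannianBundle E (fun x : M => TangentSpace 𝓘(ℝ, E) x)]
  [IsRiemannianManifold 𝓘(ℝ, E) M] [MeasurableSpace M] [BorelSpace M]

variable (E M) in
theorem hasEuclideanCharts_riemannianVolume :
    HasEuclideanCharts (riemannianVolume E M) (Module.finrank ℝ E) := by
  intro x
  set d := Module.finrank ℝ E
  obtain ⟨C₁, U₁, hU₁, h₁⟩ := eventually_lipschitz_extChartAt_symm (E := E) x
  obtain ⟨C₂, U₂, hU₂, h₂⟩ := eventually_lipschitz_extChartAt (E := E) x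
  let L : E ≃L[ℝ] (Fin d → ℝ) := ContinuousLinearEquiv.ofFinrankEq (by simp [d])
  set c : ℝ≥0 := addHaarScalarFactor (volume : Measure (EuclideanSpace ℝ (Fin d))) μH[d]
  have hc : c ≠ 0 := addHaarScalarFactor_volume_hausdorffMeasure_ne_zero d
  have hvol : ∀ S : Set M, riemannianVolume E M S = c * μH[d] S := fun S => rfl
  set K₁ := C₁ * ‖(L.symm : (Fin d → ℝ) →L[ℝ] E)‖₊
  set K₂ := ‖(L : E →L[ℝ] (Fin d → ℝ))‖₊ * C₂
  let φ : M → Fin d → ℝ := fun y => L (extChartAt 𝓘(ℝ, E) x y)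
  have hφ₁ : ∀ y ∈ U₁, ∀ z ∈ U₁, edist y z ≤ K₁ * edist (φ y) (φ z) := fun y hy z hz => by
    refine (h₁ y hy z hz).trans ?_
    rw [ENNReal.coe_mul, mul_assoc]
    gcongr
    simpa [φ] using L.symm.lipschitz (φ y) (φ z)
  have hφ₂ : LipschitzOnWith K₂ φ U₂ := fun y hy z hz => by
    refine (L.lipschitz _ _).trans ?_
    rw [ENNReal.coe_mul, mul_assoc]
    gcongr
    exact h₂ y hy z hz
  have hv : ∀ A : Set (Fin d → ℝ), volume A = μH[d] A := fun A => by
    rw [← hausdorffMeasure_pi_real, Fintype.card_fin]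
  have hd0 : (0 : ℝ) ≤ d := by positivity
  have hμ : ∀ S ⊆ U₁, μH[d] S ≤ (K₁ : ℝ≥0∞) ^ (d : ℝ) * volume (φ '' S) := by
    intro S hS
    rcases S.eq_empty_or_nonempty with rfl | hne
    · simp
    have : Nonempty M := ⟨hne.some⟩
    have hinj : InjOn φ S := fun y hy z hz hyz => by
      have := hφ₁ y (hS hy) z (hS hz)
      rwa [hyz, edist_self, mul_zero, nonpos_iff_eq_zero, edist_eq_zero] at this
    have hinv : ∀ y ∈ S, Function.invFunOn φ S (φ y) = y := hinj.leftInvOn_invFunOn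
    have hlip : LipschitzOnWith K₁ (Function.invFunOn φ S) (φ '' S) := by
      rintro _ ⟨y, hy, rfl⟩ _ ⟨z, hz, rfl⟩
      rw [hinv y hy, hinv z hz]
      exact hφ₁ y (hS hy) z (hS hz)
    have himg : Function.invFunOn φ S '' (φ '' S) = S := by
      rw [image_image]
      exact (image_congr hinv).trans (image_id' S)
    have := hlip.hausdorffMeasure_image_le hd0
    rwa [himg, ← hv] at this
  -- The three summands of the constant serve the three required bounds, in this order.
  refine ⟨U₁ ∩ U₂, inter_mem hU₁ hU₂, φ, K₁ + c⁻¹ * K₂ ^ (d : ℝ) + c * (K₁ ^ (d : ℝ) * K₂ ^ d),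
    fun y hy z hz => ?_, fun S hS => ?_, fun S hS => ?_⟩
  · refine (hφ₁ y hy.1 z hz.1).trans ?_
    gcongr
    rw [add_assoc]; exact le_self_add
  · rw [hv, hvol]
    refine ((hφ₂.mono (hS.trans inter_subset_right)).hausdorffMeasure_image_le hd0).trans ?_
    calc (K₂ : ℝ≥0∞) ^ (d : ℝ) * μH[d] S = (c⁻¹ * K₂ ^ (d : ℝ) : ℝ≥0) * (c * μH[d] S) := by
          rw [← mul_assoc, ← ENNReal.coe_mul, mul_right_comm, inv_mul_cancel₀ hc, one_mul,
            ENNReal.coe_rpow_of_nonneg _ hd0]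
      _ ≤ _ := by
        gcongr
        rw [add_right_comm]; exact le_add_self
  · rw [hvol]
    calc c * μH[d] S ≤ c * ((K₁ : ℝ≥0∞) ^ (d : ℝ) * volume (φ '' S)) := by
          gcongr; exact hμ S (hS.trans inter_subset_left)
      _ ≤ c * ((K₁ : ℝ≥0∞) ^ (d : ℝ) * (K₂ * ediam S) ^ d) := by
          gcongr
          have := Real.volume_pi_le_diam_pow (φ '' S)
          rw [Fintype.card_fin] at this
          refine this.trans ?_
          gcongr
          refine ediam_le ?_
          rintro _ ⟨y, hy, rfl⟩ _ ⟨z, hz, rfl⟩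
          refine (hφ₂ (hS hy).2 (hS hz).2).trans ?_
          gcongr
          exact edist_le_ediam_of_mem hy hz
      _ = (c * (K₁ ^ (d : ℝ) * K₂ ^ d) : ℝ≥0) * ediam S ^ d := by
          push_cast
          rw [ENNReal.coe_rpow_of_nonneg _ hd0]; ring
      _ ≤ _ := by
        gcongr
        exact le_add_self

/-- Smooth parametrizations are locally Lipschitz for the Riemannian distance, so images of small
pieces of ℝ^p have finite p-measure, and countably many of them suffice. This supplies the
σ-finiteness on the product set. -/
theorem IsEmbeddedSubmanifold.isSigmaFiniteOn [SecondCountableTopology M] {N p : ℕ}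
    {S : Set (Fin N → M)} (h : IsEmbeddedSubmanifold E p S) : IsSigmaFiniteOn μH[p] S := by
  choose! U V f hUo hzU hVo himg _ hsm _ using h
  obtain ⟨t, htS, ht, hSt⟩ := TopologicalSpace.countable_cover_nhdsWithin
    (f := U) (s := S) fun z hz => mem_nhdsWithin_of_mem_nhds ((hUo z hz).mem_nhds (hzU z hz))
  suffices hloc : ∀ z ∈ t, IsSigmaFiniteOn μH[p] (S ∩ U z) by
    refine (IsSigmaFiniteOn.biUnion ht hloc).mono fun z hz => ?_
    obtain ⟨y, hy, hzy⟩ := mem_iUnion₂.1 (hSt hz)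
    exact mem_iUnion₂.2 ⟨y, hy, hz, hzy⟩
  intro z hz
  rw [← himg z (htS hz)]
  have hV := hVo z (htS hz)
  have hlip : ∀ v ∈ V z, ∃ W ∈ 𝓝 v, ∃ K : ℝ≥0, LipschitzOnWith K (f z) W := by
    intro v hv
    have hi : ∀ i, ∃ W ∈ 𝓝 v, ∃ K : ℝ≥0, LipschitzOnWith K (fun w => f z w i) W := by
      intro i
      obtain ⟨C, A, hA, hC⟩ := eventually_lipschitz_extChartAt_symm (E := E) (f z v i)
      have hcm : ContMDiffAt 𝓘(ℝ, EuclideanSpace ℝ (Fin p)) 𝓘(ℝ, E) 1 (fun w => f z w i) v :=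
        ((hsm z (htS hz) i).contMDiffAt (hV.mem_nhds hv)).of_le (by simp)
      have hcd : ContDiffAt ℝ 1 (fun w => extChartAt 𝓘(ℝ, E) (f z v i) (f z w i)) v := by
        rw [← contMDiffAt_iff_contDiffAt]
        exact (contMDiffAt_extChartAt (x := f z v i)).comp v hcm
      obtain ⟨K, W, hW, hK⟩ := hcd.exists_lipschitzOnWith
      refine ⟨W ∩ (fun w => f z w i) ⁻¹' A,
        inter_mem hW (hcm.continuousAt.preimage_mem_nhds hA), C * K, fun w hw w' hw' => ?_⟩
      refine (hC _ hw.2 _ hw'.2).trans ?_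
      rw [ENNReal.coe_mul, mul_assoc]
      gcongr
      exact hK hw.1 hw'.1
    choose W hW K hK using hi
    refine ⟨⋂ i, W i, iInter_mem.2 hW, ∑ i, K i, fun w hw w' hw' => ?_⟩
    rw [edist_pi_le_iff]
    intro i
    refine (hK i (mem_iInter.1 hw i) (mem_iInter.1 hw' i)).trans ?_
    gcongr
    exact Finset.single_le_sum (f := K) (fun _ _ => zero_le) (Finset.mem_univ i)
  choose! W hW K hK using hlip
  obtain ⟨r, hrV, hr, hVr⟩ := TopologicalSpace.countable_cover_nhdsWithin
    (f := fun v => W v ∩ ball v 1) (s := V z)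
    fun v hv => mem_nhdsWithin_of_mem_nhds (inter_mem (hW v hv) (ball_mem_nhds v one_pos))
  refine (IsSigmaFiniteOn.biUnion (A := fun v => f z '' (W v ∩ ball v 1)) hr
    fun v hv => .of_measure_ne_top ?_).mono ?_
  · have hfin : μH[p] (W v ∩ ball v 1) ≠ ⊤ := by
      have : IsAddHaarMeasure (μH[p] : Measure (EuclideanSpace ℝ (Fin p))) := by
        have := isAddHaarMeasure_hausdorffMeasure (E := EuclideanSpace ℝ (Fin p))
        rwa [finrank_euclideanSpace_fin] at this
      exact ne_top_of_le_ne_top measure_ball_lt_top.ne (measure_mono inter_subset_right)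
    refine ne_top_of_le_ne_top ?_ (((hK v (hrV hv)).mono inter_subset_left).hausdorffMeasure_image_le
      (by positivity))
    exact ENNReal.mul_ne_top (ENNReal.rpow_ne_top_of_nonneg (by positivity) ENNReal.coe_ne_top) hfin
  · rw [← image_iUnion₂]
    exact image_mono hVr

end RiemannianVolume

/-! ### A criterion for s-finite kernels. -/

section SFiniteKernel
variable {α β : Type*} [MeasurableSpace α] [MeasurableSpace β]

/-- A kernel that is finite on the sets of a countable cover is s-finite. -/
theorem isSFiniteKernel_of_cover (κ : Kernel α β) {B : ℕ → Set β} (hB : ∀ n, MeasurableSet (B n))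
    (hcov : ⋃ n, B n = univ) (hfin : ∀ a n, κ a (B n) ≠ ⊤) : IsSFiniteKernel κ := by
  set D := disjointed B
  have hD : ∀ n, MeasurableSet (D n) := fun n => .disjointed hB n
  -- The mass of D n is finite for each a but not uniformly in a. Sorting a by the integer part of
  -- this mass gives pieces with uniform bounds.
  let A : ℕ × ℕ → Set α := fun p => {a | (p.2 : ℝ≥0∞) ≤ κ a (D p.1) ∧ κ a (D p.1) < p.2 + 1}
  have hA : ∀ p, MeasurableSet (A p) := fun p =>
    (measurableSet_le measurable_const (κ.measurable_coe (hD _))).inter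
      (measurableSet_lt (κ.measurable_coe (hD _)) measurable_const)
  classical
  let K : ℕ × ℕ → Kernel α β := fun p => Kernel.piecewise (hA p) (κ.restrict (hD p.1)) 0
  have hK : ∀ p, IsFiniteKernel (K p) := fun p => ⟨⟨p.2 + 1, by simp, fun a => by
    rw [Kernel.piecewise_apply']
    split_ifs with h
    · rw [Kernel.restrict_apply, Measure.restrict_apply_univ]; exact h.2.le
    · simp⟩⟩
  have hsum : κ = Kernel.sum K := by
    ext a s hs
    rw [Kernel.sum_apply' _ _ hs]
    refine Eq.trans ?_ (ENNReal.tsum_prod (f := fun n k => K (n, k) a s)).symm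
    have h1 : ∀ n, ∑' k, K (n, k) a s = κ a (s ∩ D n) := fun n => by
      have hne : κ a (D n) ≠ ⊤ :=
        ne_top_of_le_ne_top (hfin a n) (measure_mono (disjointed_subset B n))
      have hk : ∀ k : ℕ, a ∈ A (n, k) ↔ k = ⌊(κ a (D n)).toReal⌋₊ := fun k => by
        simp only [A, mem_ofPred_eq]
        rw [eq_comm, Nat.floor_eq_iff ENNReal.toReal_nonneg]
        conv_lhs => rw [← ENNReal.ofReal_toReal hne]
        rw [← ENNReal.ofReal_natCast, ← ENNReal.ofReal_one,
          ← ENNReal.ofReal_add (by positivity) (by positivity),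
          ENNReal.ofReal_le_ofReal_iff ENNReal.toReal_nonneg,
          ENNReal.ofReal_lt_ofReal_iff (by positivity)]
      rw [tsum_eq_single ⌊(κ a (D n)).toReal⌋₊]
      · rw [Kernel.piecewise_apply', if_pos ((hk _).2 rfl), Kernel.restrict_apply,
          Measure.restrict_apply hs]
      · intro k hk'
        rw [Kernel.piecewise_apply', if_neg (fun h => hk' ((hk k).1 h))]
        simp
    simp_rw [h1]
    rw [← measure_iUnion (fun i j hij => ((disjoint_disjointed B) hij).mono inter_subset_right
      inter_subset_right) fun n => hs.inter (hD n), ← inter_iUnion, iUnion_disjointed, hcov,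
      inter_univ]
  rw [hsum]
  infer_instance

end SFiniteKernel

/-! ### Measurability on the space of configurations. -/

namespace PointConfig
open Metric

variable {X : Type*} [MetricSpace X]

theorem countable_carrier (ξ : PointConfig X) : ξ.carrier.Countable := by
  rcases isEmpty_or_nonempty X with h | ⟨⟨x⟩⟩
  · exact Set.to_countable _
  · rw [← inter_univ ξ.carrier, ← iUnion_ball_nat x, inter_iUnion]
    exact countable_iUnion fun n => (ξ.finite_inter _ isBounded_ball).countable

@[ext]
theorem ext {ξ ξ' : PointConfig X} (h : ξ.carrier = ξ'.carrier) : ξ = ξ' := by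
  cases ξ; cases ξ'; congr

/-- The configuration that agrees with `ξ` on `D` and with `η` outside `D`. -/
def glue (D : Set X) (η ξ : PointConfig X) : PointConfig X where
  carrier := ξ.carrier ∩ D ∪ η.carrier ∩ Dᶜ
  finite_inter := fun B hB =>
    ((ξ.finite_inter B hB).union (η.finite_inter B hB)).subset fun _ hx =>
      hx.1.elim (fun h => Or.inl ⟨h.1, hx.2⟩) fun h => Or.inr ⟨h.1, hx.2⟩

/-- The tuples of distinct points of a configuration. -/
def tuples (r : ℕ) (ξ : PointConfig X) : Set (Fin r → X) :=
  {s | Function.Injective s ∧ ∀ i, s i ∈ ξ.carrier}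

theorem countable_tuples (r : ℕ) (ξ : PointConfig X) : (tuples r ξ).Countable :=
  have h : tuples r ξ ⊆ univ.pi fun _ => ξ.carrier := fun _ hs i _ => hs.2 i
  (countable_univ_pi fun _ : Fin r => ξ.countable_carrier).mono h

/-- The configuration `ξ ∖ s`. -/
def remove {r : ℕ} (s : Fin r → X) (ξ : PointConfig X) : PointConfig X :=
  ξ.restrict (range s)ᶜ

variable [MeasurableSpace X] [SecondCountableTopology X] [BorelSpace X]

theorem measurableSet_carrier (ξ : PointConfig X) : MeasurableSet ξ.carrier :=
  ξ.countable_carrier.measurableSet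

theorem countingMeasure_apply (ξ : PointConfig X) {B : Set X} (hB : MeasurableSet B) :
    ξ.countingMeasure B = (B ∩ ξ.carrier).encard := by
  rw [countingMeasure, Measure.restrict_apply hB, Measure.count_apply
    (hB.inter ξ.measurableSet_carrier)]

theorem countingMeasure_ne_top (ξ : PointConfig X) {B : Set X} (hB : MeasurableSet B)
    (hb : Bornology.IsBounded B) : ξ.countingMeasure B ≠ ⊤ := by
  rw [ξ.countingMeasure_apply hB, inter_comm]
  simpa using ξ.finite_inter B hb

theorem countingMeasure_restrict (ξ : PointConfig X) {A : Set X} (hA : MeasurableSet A) :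
    (ξ.restrict A).countingMeasure = ξ.countingMeasure.restrict A := by
  rw [countingMeasure, countingMeasure, Measure.restrict_restrict hA]
  simp [restrict, inter_comm]

theorem measurable_countingMeasure :
    Measurable (countingMeasure : PointConfig X → Measure X) :=
  comap_measurable _

theorem measurable_iff {Ω : Type*} [MeasurableSpace Ω] {f : Ω → PointConfig X} :
    Measurable f ↔ ∀ B, MeasurableSet B → Measurable fun w => (f w).countingMeasure B := by
  rw [measurable_comap_iff, Measure.measurable_measure]
  rfl

theorem measurable_countingMeasure_apply {B : Set X} (hB : MeasurableSet B) :
    Measurable fun ξ : PointConfig X => ξ.countingMeasure B :=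
  (Measure.measurable_coe hB).comp measurable_countingMeasure

theorem measurable_restrict {A : Set X} (hA : MeasurableSet A) :
    Measurable (restrict A : PointConfig X → PointConfig X) := by
  refine measurable_iff.2 fun B hB => ?_
  simp_rw [countingMeasure_restrict _ hA, Measure.restrict_apply hB]
  exact measurable_countingMeasure_apply (hB.inter hA)

theorem measurable_glue {D : Set X} (hD : MeasurableSet D) :
    Measurable fun p : PointConfig X × PointConfig X => glue D p.1 p.2 := by
  refine measurable_iff.2 fun B hB => ?_
  have h : ∀ p : PointConfig X × PointConfig X, (glue D p.1 p.2).countingMeasure B =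
      p.2.countingMeasure (B ∩ D) + p.1.countingMeasure (B ∩ Dᶜ) := fun p => by
    rw [countingMeasure_apply _ hB, countingMeasure_apply _ (hB.inter hD),
      countingMeasure_apply _ (hB.inter hD.compl), ← ENat.toENNReal_add, ← encard_union_eq]
    · congr 2
      ext x; simp only [glue, mem_inter_iff, mem_union, mem_compl_iff]; tauto
    · exact disjoint_left.2 fun x hx hx' => hx'.1.2 hx.1.2
  simp_rw [h]
  exact ((measurable_countingMeasure_apply (hB.inter hD)).comp measurable_snd).add
    ((measurable_countingMeasure_apply (hB.inter hD.compl)).comp measurable_fst)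

theorem exists_cover_isOpen_isBounded (X : Type*) [MetricSpace X] :
    ∃ B : ℕ → Set X, Monotone B ∧ (∀ n, IsOpen (B n)) ∧
      (∀ n, Bornology.IsBounded (B n)) ∧ ⋃ n, B n = univ := by
  rcases isEmpty_or_nonempty X with h | ⟨⟨x⟩⟩
  · exact ⟨fun _ => ∅, monotone_const, by simp, by simp, Subsingleton.elim _ _⟩
  · exact ⟨fun n => ball x n, fun a b hab => ball_subset_ball (by exact_mod_cast hab),
      fun n => isOpen_ball, fun n => isBounded_ball, iUnion_ball_nat x⟩

variable (X) in
/-- The counting measures as a kernel. -/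
def countingKernel : Kernel (PointConfig X) X := ⟨countingMeasure, measurable_countingMeasure⟩

instance : IsSFiniteKernel (countingKernel X) := by
  obtain ⟨B, -, hBo, hb, hcov⟩ := exists_cover_isOpen_isBounded X
  have hB := fun n => (hBo n).measurableSet
  exact isSFiniteKernel_of_cover _ hB hcov fun ξ n => ξ.countingMeasure_ne_top (hB n) (hb n)

/-- The set removed varies with the tuple, so the count of what remains is the counting kernel
evaluated on a section; s-finiteness makes this jointly measurable. -/
theorem measurable_remove (r : ℕ) :
    Measurable fun p : (Fin r → X) × PointConfig X => remove p.1 p.2 := by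
  refine measurable_iff.2 fun B hB => ?_
  have ht : MeasurableSet {q : ((Fin r → X) × PointConfig X) × X |
      q.2 ∈ B ∧ q.2 ∉ range q.1.1} := by
    have : {q : ((Fin r → X) × PointConfig X) × X | q.2 ∈ range q.1.1} =
        ⋃ i, {q | q.1.1 i = q.2} := by ext; simp
    have hm : MeasurableSet {q : ((Fin r → X) × PointConfig X) × X | q.2 ∈ range q.1.1} := by
      rw [this]
      exact MeasurableSet.iUnion fun i => measurableSet_eq_fun
        ((measurable_pi_apply i).comp (measurable_fst.comp measurable_fst)) measurable_snd
    exact (measurable_snd hB).inter hm.compl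
  have h : (fun p : (Fin r → X) × PointConfig X => (remove p.1 p.2).countingMeasure B) =
      fun p => Kernel.prodMkLeft (Fin r → X) (countingKernel X) p
        (Prod.mk p ⁻¹' {q | q.2 ∈ B ∧ q.2 ∉ range q.1.1}) := by
    ext p
    rw [remove, countingMeasure_restrict _ (finite_range _).measurableSet.compl,
      Measure.restrict_apply hB]
    rfl
  rw [h]
  exact Kernel.measurable_kernel_prodMk_left ht

theorem factorialMeasure_apply (r : ℕ) (ξ : PointConfig X) {A : Set (Fin r → X)}
    (hA : MeasurableSet A) : factorialMeasure r ξ A = (A ∩ tuples r ξ).encard := by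
  rw [factorialMeasure, Measure.restrict_apply hA]
  exact Measure.count_apply (hA.inter (countable_tuples r ξ).measurableSet)

theorem factorialMeasure_eq_zero_iff {r : ℕ} {ξ : PointConfig X} {A : Set (Fin r → X)}
    (hA : MeasurableSet A) : factorialMeasure r ξ A = 0 ↔ ∀ s ∈ tuples r ξ, s ∉ A := by
  rw [factorialMeasure_apply r ξ hA, ENat.toENNReal_eq_zero, encard_eq_zero,
    eq_empty_iff_forall_notMem]
  exact ⟨fun h s hs hA => h s ⟨hA, hs⟩, fun h s hs => h s hs.2 hs.1⟩

/-- On a bounded window the ordered tuples of points are counted by the r-fold product of the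
counting measure, a finite measure whose measurability can be tested on boxes. Restricting to
injective tuples and letting the window grow gives the factorial measure as a supremum. -/
theorem measurable_factorialMeasure (r : ℕ) :
    Measurable (factorialMeasure r : PointConfig X → Measure (Fin r → X)) := by
  obtain ⟨B, hBm, hBo, hb, hcov⟩ := exists_cover_isOpen_isBounded X
  have hB := fun n => (hBo n).measurableSet
  have hfin : ∀ n (ξ : PointConfig X), IsFiniteMeasure (ξ.countingMeasure.restrict (B n)) :=
    fun n ξ => ⟨by
      rw [Measure.restrict_apply_univ]; exact (ξ.countingMeasure_ne_top (hB n) (hb n)).lt_top⟩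
  have h1 : ∀ n, Measurable fun ξ : PointConfig X =>
      Measure.pi fun _ : Fin r => ξ.countingMeasure.restrict (B n) := fun n => by
    refine Measurable.measure_of_isPiSystem generateFrom_pi.symm isPiSystem_pi ?_ ?_
    · rintro _ ⟨s, hs, rfl⟩
      simp_rw [Measure.pi_pi]
      refine Finset.measurable_prod _ fun i _ => ?_
      simp_rw [Measure.restrict_apply (hs i trivial)]
      exact measurable_countingMeasure_apply ((hs i trivial).inter (hB n))
    · simp_rw [← pi_univ univ, Measure.pi_pi]
      refine Finset.measurable_prod _ fun i _ => ?_
      simp_rw [Measure.restrict_apply_univ]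
      exact measurable_countingMeasure_apply (hB n)
  have hinj : MeasurableSet {s : Fin r → X | Function.Injective s} := by
    have : {s : Fin r → X | Function.Injective s} =
        ⋂ i, ⋂ j, {s | s i = s j → i = j} := by ext; simp [Function.Injective]
    rw [this]
    refine MeasurableSet.iInter fun i => MeasurableSet.iInter fun j => ?_
    by_cases hij : i = j
    · simp [hij]
    · simp only [hij, imp_false]
      exact (measurableSet_eq_fun (measurable_pi_apply i) (measurable_pi_apply j)).compl
  have hS : ∀ (ξ : PointConfig X) n, {s : Fin r → X | ∀ i, s i ∈ ξ.carrier ∩ B n} =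
      univ.pi fun _ => ξ.carrier ∩ B n := fun ξ n => by ext; simp
  have hSm : ∀ (ξ : PointConfig X) n,
      MeasurableSet {s : Fin r → X | ∀ i, s i ∈ ξ.carrier ∩ B n} := fun ξ n => by
    rw [hS]
    exact .univ_pi fun _ => ξ.measurableSet_carrier.inter (hB n)
  have h2 : ∀ (ξ : PointConfig X) n {A : Set (Fin r → X)}, MeasurableSet A →
      (Measure.pi fun _ : Fin r => ξ.countingMeasure.restrict (B n)) A =
        Measure.count (A ∩ {s | ∀ i, s i ∈ ξ.carrier ∩ B n}) := fun ξ n A hA => by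
    rw [← Measure.restrict_apply hA]
    congr 1
    refine Measure.pi_eq fun s hs => ?_
    rw [Measure.restrict_apply (.univ_pi hs), hS, ← pi_inter_distrib, Measure.count_apply
      (.univ_pi fun i => (hs i).inter (ξ.measurableSet_carrier.inter (hB n))),
      encard_pi_eq_prod_encard, ← ENat.toENNRealRingHom_apply, map_prod]
    refine Finset.prod_congr rfl fun i _ => ?_
    rw [ENat.toENNRealRingHom_apply, Measure.restrict_apply (hs i),
      countingMeasure_apply _ ((hs i).inter (hB n)), inter_assoc, inter_comm (B n)]
  refine Measure.measurable_measure.2 fun A hA => ?_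
  have h3 : ∀ ξ : PointConfig X, factorialMeasure r ξ A = ⨆ n,
      (Measure.pi fun _ : Fin r => ξ.countingMeasure.restrict (B n))
        (A ∩ {s : Fin r → X | Function.Injective s}) := fun ξ => by
    simp_rw [h2 ξ _ (hA.inter hinj)]
    rw [factorialMeasure, Measure.restrict_apply hA, ← Monotone.measure_iUnion]
    · congr 1
      ext s
      simp only [mem_inter_iff, mem_ofPred_eq, mem_iUnion]
      constructor
      · rintro ⟨hsA, hs, hξ⟩
        choose n hn using fun i => mem_iUnion.1 (hcov.symm ▸ mem_univ (s i))
        exact ⟨Finset.univ.sup n, ⟨hsA, hs⟩, fun i => ⟨hξ i,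
          hBm (Finset.le_sup (Finset.mem_univ i)) (hn i)⟩⟩
      · rintro ⟨n, ⟨hsA, hs⟩, h⟩
        exact ⟨hsA, hs, fun i => (h i).1⟩
    · exact fun n n' hn s hs => ⟨hs.1, fun i => ⟨(hs.2 i).1, hBm hn (hs.2 i).2⟩⟩
  simp_rw [h3]
  exact Measurable.iSup fun n => (Measure.measurable_coe (hA.inter hinj)).comp (h1 n)

theorem measurable_ofVector (N : ℕ) :
    Measurable (ofVector : (Fin N → X) → PointConfig X) := by
  refine measurable_iff.2 fun B hB => ?_
  -- Coordinates may coincide, so each point is counted at its least index only.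
  have h : ∀ z : Fin N → X, (ofVector z).countingMeasure B =
      ∑ i, {z : Fin N → X | z i ∈ B ∧ ∀ j < i, z j ≠ z i}.indicator (fun _ => (1 : ℝ≥0∞)) z := by
    intro z
    classical
    rw [countingMeasure_apply _ hB]
    have h1 : B ∩ (ofVector z).carrier =
        z '' ((Finset.univ.filter fun i => z i ∈ B ∧ ∀ j < i, z j ≠ z i : Finset (Fin N)) :
          Set (Fin N)) := by
      ext x
      simp only [ofVector, mem_inter_iff, mem_range, Finset.coe_filter, Finset.mem_univ, true_and,
        mem_image, mem_ofPred_eq]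
      constructor
      · rintro ⟨hx, hex⟩
        obtain ⟨i, hi, hmin⟩ := WellFounded.has_min (wellFounded_lt (α := Fin N)) {i | z i = x} hex
        have hi' : z i = x := hi
        exact ⟨i, ⟨by rwa [hi'], fun j hj hji => hmin j (hji.trans hi') hj⟩, hi'⟩
      · rintro ⟨i, hi, rfl⟩
        exact ⟨hi.1, i, rfl⟩
    rw [h1, InjOn.encard_image, encard_coe_eq_coe_finsetCard, Finset.card_filter]
    · simp [indicator]
    · intro i hi j hj hij
      simp only [Finset.coe_filter, Finset.mem_univ, true_and, mem_ofPred_eq] at hi hj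
      rcases lt_trichotomy i j with hlt | rfl | hlt
      · exact absurd hij (hj.2 i hlt)
      · rfl
      · exact absurd hij.symm (hi.2 j hlt)
  simp_rw [h]
  refine Finset.measurable_sum _ fun i _ => measurable_const.indicator ?_
  refine (measurable_pi_apply i hB).inter ?_
  have h2 : {z : Fin N → X | ∀ j < i, z j ≠ z i} = ⋂ j, ⋂ _ : j < i, {z | z j = z i}ᶜ := by
    ext; simp
  have h3 : MeasurableSet {z : Fin N → X | ∀ j < i, z j ≠ z i} := by
    rw [h2]
    exact .iInter fun j => .iInter fun _ =>
      (measurableSet_eq_fun (measurable_pi_apply j) (measurable_pi_apply i)).compl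
  exact h3

/-- Counts on a countable algebra of sets, cut down to bounded windows, determine the
configuration's counting measure measurably. Countable generation is what lets absolute continuity
of composition-products pass to almost every kernel value, through `kernel_of_compProd`. -/
instance : MeasurableSpace.CountablyGenerated (PointConfig X) := by
  obtain ⟨B, hBm, hBo, hb, hcov⟩ := exists_cover_isOpen_isBounded X
  have hB := fun n => (hBo n).measurableSet
  set 𝒜 := generateSetAlgebra (MeasurableSpace.countableGeneratingSet X) with h𝒜
  have hc : 𝒜.Countable :=
    countable_generateSetAlgebra (MeasurableSpace.countable_countableGeneratingSet (α := X))
  have hgen : ‹MeasurableSpace X› = MeasurableSpace.generateFrom 𝒜 := by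
    rw [h𝒜, generateFrom_generateSetAlgebra_eq, MeasurableSpace.generateFrom_countableGeneratingSet]
  have halg : IsSetAlgebra 𝒜 := isSetAlgebra_generateSetAlgebra
  have hA : ∀ A ∈ 𝒜, MeasurableSet A := fun A hA => by
    rw [hgen]; exact MeasurableSpace.measurableSet_generateFrom hA
  have : Countable 𝒜 := hc.to_subtype
  let e : PointConfig X → (ℕ × 𝒜 → ℝ≥0∞) := fun ξ p => ξ.countingMeasure (p.2 ∩ B p.1)
  have he : (inferInstance : MeasurableSpace (PointConfig X)) =
      MeasurableSpace.comap e inferInstance := by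
    refine le_antisymm ?_ ?_
    · refine Measurable.comap_le (@Measure.measurable_of_measurable_coe _ _ _
        (MeasurableSpace.comap e inferInstance) _ fun A hAm => ?_)
      have h1 : ∀ n, @Measurable _ _ (MeasurableSpace.comap e inferInstance) _
          fun ξ : PointConfig X => ξ.countingMeasure.restrict (B n) := fun n => by
        have hfin : ∀ ξ : PointConfig X, IsFiniteMeasure (ξ.countingMeasure.restrict (B n)) :=
          fun ξ => ⟨by
            rw [Measure.restrict_apply_univ]
            exact (ξ.countingMeasure_ne_top (hB n) (hb n)).lt_top⟩
        have h2 : ∀ A ∈ 𝒜, @Measurable _ _ (MeasurableSpace.comap e inferInstance) _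
            fun ξ : PointConfig X => ξ.countingMeasure.restrict (B n) A := fun A hA' => by
          simp_rw [Measure.restrict_apply (hA A hA')]
          exact (measurable_pi_apply ((n, ⟨A, hA'⟩) : ℕ × 𝒜)).comp (comap_measurable e)
        refine @Measurable.measure_of_isPiSystem _ _ (MeasurableSpace.comap e inferInstance) _ _
          hfin 𝒜 hgen halg.isSetRing.isSetSemiring.isPiSystem h2 (h2 univ halg.univ_mem)
      have h3 : ∀ ξ : PointConfig X, ξ.countingMeasure A =
          ⨆ n, ξ.countingMeasure.restrict (B n) A := fun ξ => by
        simp_rw [Measure.restrict_apply hAm]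
        rw [← Monotone.measure_iUnion, ← inter_iUnion, hcov, inter_univ]
        exact fun i j hij => inter_subset_inter_right _ (hBm hij)
      simp_rw [h3]
      exact Measurable.iSup fun n => (Measure.measurable_coe hAm).comp (h1 n)
    · exact Measurable.comap_le (measurable_pi_lambda _ fun p =>
        measurable_countingMeasure_apply ((hA _ p.2.2).inter (hB _)))
  have := MeasurableSpace.CountablyGenerated.comap (β := ℕ × 𝒜 → ℝ≥0∞) e
  rwa [← he] at this

variable (X) in
/-- The factorial measures as a kernel. -/
def factorialKernel (r : ℕ) : Kernel (PointConfig X) (Fin r → X) :=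
  ⟨factorialMeasure r, measurable_factorialMeasure r⟩

theorem factorialKernel_apply (r : ℕ) (ξ : PointConfig X) :
    factorialKernel X r ξ = factorialMeasure r ξ := rfl

instance (r : ℕ) : IsSFiniteKernel (factorialKernel X r) := by
  obtain ⟨B, hBm, hBo, hb, hcov⟩ := exists_cover_isOpen_isBounded X
  have hB := fun n => (hBo n).measurableSet
  refine isSFiniteKernel_of_cover _ (B := fun n => univ.pi fun _ => B n)
    (fun n => .univ_pi fun _ => hB n) ?_ fun ξ n => ?_
  · refine eq_univ_of_forall fun s => ?_
    choose n hn using fun i => mem_iUnion.1 (hcov.symm ▸ mem_univ (s i))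
    exact mem_iUnion.2 ⟨Finset.univ.sup n, fun i _ =>
      hBm (Finset.le_sup (Finset.mem_univ i)) (hn i)⟩
  · rw [factorialKernel_apply, factorialMeasure_apply _ _ (.univ_pi fun _ => hB n)]
    have : (univ.pi (fun _ : Fin r => B n) ∩ tuples r ξ).Finite := by
      have hsub : univ.pi (fun _ : Fin r => B n) ∩ tuples r ξ ⊆
          univ.pi fun _ => ξ.carrier ∩ B n := fun s hs i hi => ⟨hs.2.2 i, hs.1 i hi⟩
      exact (Finite.pi' fun _ => ξ.finite_inter _ (hb n)).subset
        (hsub.trans fun s hs i => hs i trivial)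
    simpa using this

variable (X) in
/-- The reduced Campbell measures of single configurations as a kernel: to a configuration it
assigns the counting measure on the pairs of a tuple of its points and the remaining
configuration. -/
def splitKernel (r : ℕ) : Kernel (PointConfig X) ((Fin r → X) × PointConfig X) :=
  (Kernel.id ×ₖ factorialKernel X r).map fun p => (p.2, remove p.2 p.1)

theorem measurable_splitMap (r : ℕ) :
    Measurable fun p : PointConfig X × (Fin r → X) => (p.2, remove p.2 p.1) :=
  measurable_snd.prodMk ((measurable_remove r).comp measurable_swap)

instance (r : ℕ) : IsSFiniteKernel (splitKernel X r) :=
  inferInstanceAs (IsSFiniteKernel ((Kernel.id ×ₖ factorialKernel X r).map _))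

theorem splitKernel_apply (r : ℕ) (ξ : PointConfig X) {A : Set ((Fin r → X) × PointConfig X)}
    (hA : MeasurableSet A) :
    splitKernel X r ξ A = factorialMeasure r ξ {s | (s, remove s ξ) ∈ A} := by
  rw [splitKernel, Kernel.map_apply' _ (measurable_splitMap r) _ hA, Kernel.prod_apply,
    Kernel.id_apply, Measure.dirac_prod, Measure.map_apply measurable_prodMk_left
      (measurable_splitMap r hA)]
  rfl

theorem measurableSet_remove_mem {r : ℕ} (ξ : PointConfig X)
    {A : Set ((Fin r → X) × PointConfig X)} (hA : MeasurableSet A) :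
    MeasurableSet {s | (s, remove s ξ) ∈ A} :=
  (measurable_splitMap r).comp measurable_prodMk_left hA

theorem splitKernel_eq_zero_iff {r : ℕ} {ξ : PointConfig X}
    {A : Set ((Fin r → X) × PointConfig X)} (hA : MeasurableSet A) :
    splitKernel X r ξ A = 0 ↔ ∀ s ∈ tuples r ξ, (s, remove s ξ) ∉ A := by
  rw [splitKernel_apply r ξ hA, factorialMeasure_eq_zero_iff (measurableSet_remove_mem ξ hA)]
  rfl

theorem campbellMeasure_eq (P : Measure (PointConfig X)) [SFinite P] (r : ℕ) :
    campbellMeasure P r = (P ⊗ₘ factorialKernel X r).map Prod.swap := by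
  ext A hA
  have hf : Measurable fun ξ : PointConfig X => (factorialMeasure r ξ).map fun s => (s, ξ) := by
    have : (fun ξ : PointConfig X => (factorialMeasure r ξ).map fun s => (s, ξ)) =
        fun ξ => ((Kernel.id ×ₖ factorialKernel X r).map Prod.swap) ξ := by
      ext ξ A hA
      rw [Kernel.map_apply' _ measurable_swap _ hA, Kernel.prod_apply, Kernel.id_apply,
        Measure.dirac_prod, Measure.map_apply measurable_prodMk_left (measurable_swap hA),
        Measure.map_apply measurable_prodMk_right hA]
      rfl
    rw [this]
    exact Kernel.measurable _
  rw [campbellMeasure, Measure.bind_apply hA hf.aemeasurable,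
    Measure.map_apply measurable_swap hA, Measure.compProd_apply (measurable_swap hA)]
  refine lintegral_congr fun ξ => ?_
  rw [Measure.map_apply measurable_prodMk_right hA]
  rfl

theorem measurable_linearStatistic_restrict {φ : X → ℂ} (hφ : Measurable φ) {D : Set X}
    (hD : MeasurableSet D) :
    Measurable fun ξ : PointConfig X => linearStatistic φ (ξ.restrict D).countingMeasure := by
  have : StronglyMeasurable fun ξ : PointConfig X => ∫ x, φ x ∂(countingKernel X ξ) :=
    hφ.stronglyMeasurable.integral_kernel
  exact this.measurable.comp (measurable_restrict hD)

end PointConfig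

/-! ### Calculus of mutual absolute continuity. -/

section MutuallyAC
variable {α β : Type*} [MeasurableSpace α] [MeasurableSpace β]

theorem MutuallyAC.refl (μ : Measure α) : MutuallyAC μ μ := ⟨.refl _, .refl _⟩

theorem MutuallyAC.symm {μ ν : Measure α} (h : MutuallyAC μ ν) : MutuallyAC ν μ := ⟨h.2, h.1⟩

theorem MutuallyAC.trans {μ ν ρ : Measure α} (h : MutuallyAC μ ν) (h' : MutuallyAC ν ρ) :
    MutuallyAC μ ρ := ⟨h.1.trans h'.1, h'.2.trans h.2⟩

theorem MutuallyAC.map {μ ν : Measure α} (h : MutuallyAC μ ν) {f : α → β} (hf : Measurable f) :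
    MutuallyAC (μ.map f) (ν.map f) := ⟨h.1.map hf, h.2.map hf⟩

theorem MutuallyAC.restrict {μ ν : Measure α} (h : MutuallyAC μ ν) (S : Set α) :
    MutuallyAC (μ.restrict S) (ν.restrict S) := ⟨h.1.restrict S, h.2.restrict S⟩

theorem MutuallyAC.of_forall {μ ν : Measure α}
    (h : ∀ A, MeasurableSet A → (μ A = 0 ↔ ν A = 0)) : MutuallyAC μ ν :=
  ⟨.mk fun A hA => (h A hA).2, .mk fun A hA => (h A hA).1⟩

theorem MutuallyAC.ae_iff {μ ν : Measure α} (h : MutuallyAC μ ν) {q : α → Prop} :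
    (∀ᵐ x ∂μ, q x) ↔ ∀ᵐ x ∂ν, q x := ⟨fun H => h.2.ae_le H, fun H => h.1.ae_le H⟩

theorem MutuallyAC.smul {μ : Measure α} {c : ℝ≥0∞} (hc : c ≠ 0) : MutuallyAC (c • μ) μ :=
  .of_forall fun A _ => by simp [hc]

theorem MutuallyAC.prod {μ μ' : Measure α} {ν ν' : Measure β} [SFinite ν] [SFinite ν']
    (h : MutuallyAC μ μ') (h' : MutuallyAC ν ν') : MutuallyAC (μ.prod ν) (μ'.prod ν') :=
  ⟨h.1.prod h'.1, h.2.prod h'.2⟩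

/-- In a product decomposition of a measure up to null sets, the second factor can be taken to be
the second marginal. -/
theorem MutuallyAC.prod_snd {K : Measure (α × β)} [SFinite K] {μ : Measure α} {τ : Measure β}
    [SFinite τ] (h : MutuallyAC K (μ.prod τ)) : MutuallyAC K (μ.prod K.snd) := by
  by_cases h0 : μ = 0
  · subst h0
    rw [Measure.zero_prod] at h ⊢
    exact h
  · have h1 : MutuallyAC K.snd τ := by
      refine (h.map measurable_snd).trans ?_
      rw [Measure.map_snd_prod]
      exact .smul (by simpa using h0)
    exact h.trans (.prod (.refl _) h1.symm)

end MutuallyAC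

/-! ### Submanifold volume and sup-metric Hausdorff measure. -/

section SubmanifoldVolume
open Measure

/-- The ℓ² and sup metrics on M^N are bi-Lipschitz equivalent and the normalising factor is nonzero,
so the null sets agree. -/
theorem submanifoldVolume_mutuallyAC {M : Type*} [MetricSpace M] [MeasurableSpace M]
    [BorelSpace M] [SecondCountableTopology M] {N : ℕ} (p : ℕ) (S : Set (Fin N → M)) :
    MutuallyAC (submanifoldVolume p S) (μH[p].restrict S) := by
  refine MutuallyAC.restrict ?_ S
  have h1 : MutuallyAC (euclideanHausdorffMeasure p : Measure (PiLp 2 fun _ : Fin N => M)) μH[p] := by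
    rw [euclideanHausdorffMeasure_def]
    exact .smul (by simpa using addHaarScalarFactor_volume_hausdorffMeasure_ne_zero p)
  have hm : Measurable (WithLp.ofLp : (PiLp 2 fun _ : Fin N => M) → Fin N → M) :=
    (PiLp.continuous_ofLp 2 _).measurable
  refine (h1.map hm).trans (.of_forall fun A hA => ?_)
  rw [Measure.map_apply hm hA]
  have hl := PiLp.lipschitzWith_ofLp 2 (fun _ : Fin N => M)
  have ha := PiLp.antilipschitzWith_ofLp 2 (fun _ : Fin N => M)
  have hp : (0 : ℝ) ≤ p := by positivity
  constructor
  · intro h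
    have := hl.hausdorffMeasure_image_le hp (WithLp.ofLp ⁻¹' A)
    rw [h, mul_zero, image_preimage_eq _ (WithLp.ofLp_surjective 2)] at this
    exact le_antisymm this zero_le
  · intro h
    have := ha.hausdorffMeasure_preimage_le hp A
    rw [h, mul_zero] at this
    exact le_antisymm this zero_le

end SubmanifoldVolume

/-! ### Linear statistics and constraint sets. -/

section Statistics
variable {X : Type*} [MetricSpace X] [MeasurableSpace X] [BorelSpace X]

theorem linearStatistic_vectorMeasure {N : ℕ} (φ : X → ℂ) (ζ : Fin N → X) :
    linearStatistic φ (vectorMeasure ζ) = ∑ i, φ (ζ i) := by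
  rw [linearStatistic, vectorMeasure, integral_finsetSum_measure fun i _ => integrable_dirac (by simp)]
  simp

variable [SecondCountableTopology X]

theorem measurable_linearStatistic_vectorMeasure {N : ℕ} {φ : X → ℂ} (hφ : Measurable φ) :
    Measurable fun ζ : Fin N → X => linearStatistic φ (vectorMeasure ζ) := by
  simp_rw [linearStatistic_vectorMeasure]
  exact Finset.measurable_sum _ fun i _ => hφ.comp (measurable_pi_apply i)

theorem mem_constraintSet {t : ℕ} {Ψ : Fin t → X → ℂ} {D : Set X} {N : ℕ} {s : Fin t → ℂ}
    {ζ : Fin N → X} :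
    ζ ∈ constraintSet Ψ D N s ↔ (∀ i, ζ i ∈ D) ∧ ∀ j, ∑ i, Ψ j (ζ i) = s j := by
  simp [constraintSet, linearStatistic_vectorMeasure]

theorem measurableSet_constraintSet {t : ℕ} {Ψ : Fin t → X → ℂ} (hΨ : ∀ j, Measurable (Ψ j))
    {D : Set X} (hD : MeasurableSet D) (N : ℕ) (s : Fin t → ℂ) :
    MeasurableSet (constraintSet Ψ D N s) := by
  have : constraintSet Ψ D N s = (⋂ i, {ζ | ζ i ∈ D}) ∩
      ⋂ j, {ζ | linearStatistic (Ψ j) (vectorMeasure ζ) = s j} := by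
    ext; simp [constraintSet]
  rw [this]
  exact (MeasurableSet.iInter fun i => measurable_pi_apply i hD).inter (.iInter fun j =>
    measurable_linearStatistic_vectorMeasure (hΨ j) (measurableSet_singleton _))

/-- Additivity of the statistics. The condition on y does not involve x beyond its statistics v,
which is what makes the constraint set a product above G. -/
theorem append_mem_constraintSet {t : ℕ} {Ψ : Fin t → X → ℂ} {D : Set X} {m l : ℕ}
    {s v : Fin t → ℂ} {x : Fin m → X} {y : Fin l → X} (hx : x ∈ constraintSet Ψ D m v) :
    Fin.append x y ∈ constraintSet Ψ D (m + l) s ↔ y ∈ constraintSet Ψ D l (s - v) := by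
  rw [mem_constraintSet] at *
  rw [mem_constraintSet]
  simp_rw [Fin.sum_univ_add, Fin.append_left, Fin.append_right, hx.2, Pi.sub_apply,
    eq_sub_iff_add_eq']
  refine and_congr_left fun _ => ⟨fun h i => by simpa using h (Fin.natAdd m i), fun h i => ?_⟩
  refine Fin.addCases (fun i => ?_) (fun i => ?_) i
  · simpa using hx.1 i
  · simpa using h i

theorem comp_perm_mem_constraintSet {t : ℕ} {Ψ : Fin t → X → ℂ} {D : Set X} {N : ℕ}
    {s : Fin t → ℂ} {z : Fin N → X} (σ : Equiv.Perm (Fin N)) (hz : z ∈ constraintSet Ψ D N s) :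
    z ∘ σ ∈ constraintSet Ψ D N s := by
  rw [mem_constraintSet] at *
  exact ⟨fun i => hz.1 _, fun j => (Equiv.sum_comp σ fun i => Ψ j (z i)).trans (hz.2 j)⟩

end Statistics

/-! ### Splitting points off a configuration with prescribed statistics. -/

section Fiber
open Measure PointConfig

/-- Permuting coordinates is an isometry of the sup metric. -/
theorem ae_hausdorffMeasure_comp_perm {X : Type*} [MetricSpace X] [MeasurableSpace X]
    [BorelSpace X] [SecondCountableTopology X] {N : ℕ} {p : ℝ} (σ : Equiv.Perm (Fin N))
    {q : (Fin N → X) → Prop} (h : ∀ᵐ z ∂(μH[p] : Measure (Fin N → X)), q z) :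
    ∀ᵐ z ∂(μH[p] : Measure (Fin N → X)), q (z ∘ σ) := by
  have := (IsometryEquiv.piCongrLeft' (Y := fun _ => X) σ.symm).hausdorffMeasure_preimage p {z | ¬ q z}
  rw [ae_iff] at h ⊢
  rw [h] at this
  exact this

namespace PointConfig
variable {X : Type*} [MetricSpace X]

theorem ofVector_comp_perm {N : ℕ} (z : Fin N → X) (σ : Equiv.Perm (Fin N)) :
    ofVector (z ∘ σ) = ofVector z := by
  ext1; exact σ.surjective.range_comp z

theorem remove_ofVector_castAdd {m l : ℕ} {z : Fin (m + l) → X} (hz : Function.Injective z) :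
    remove (z ∘ Fin.castAdd l) (ofVector z) = ofVector (z ∘ Fin.natAdd m) := by
  ext1
  ext x
  simp only [remove, PointConfig.restrict, ofVector, mem_inter_iff, mem_range, mem_compl_iff,
    Function.comp]
  constructor
  · rintro ⟨⟨i, rfl⟩, hi⟩
    refine Fin.addCases (fun j hj => absurd ⟨j, rfl⟩ hj) (fun j _ => ⟨j, rfl⟩) i hi
  · rintro ⟨j, rfl⟩
    refine ⟨⟨_, rfl⟩, fun ⟨i, hi⟩ => ?_⟩
    have := congrArg Fin.val (hz hi)
    simp at this
    omega

theorem injective_of_encard_ofVector {N : ℕ} {z : Fin N → X}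
    (h : (ofVector z).carrier.encard = N) : Function.Injective z := by
  rw [← injOn_univ]
  refine finite_univ.injOn_of_encard_image_eq ?_
  rw [image_univ]
  exact h.trans (by simp)

theorem le_of_mem_tuples_ofVector {m N : ℕ} {z : Fin N → X} {s : Fin m → X}
    (hs : s ∈ tuples m (ofVector z)) : m ≤ N := by
  choose f hf using hs.2
  have : Function.Injective f := fun i j hij => hs.1 (by rw [← hf i, ← hf j, hij])
  simpa using Fintype.card_le_of_injective f this

theorem exists_perm_of_mem_tuples {m l : ℕ} {z : Fin (m + l) → X} {s : Fin m → X}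
    (hs : s ∈ tuples m (ofVector z)) : ∃ σ : Equiv.Perm (Fin (m + l)), s = z ∘ σ ∘ Fin.castAdd l := by
  choose f hf using hs.2
  have hfi : Function.Injective f := fun i j hij => hs.1 (by rw [← hf i, ← hf j, hij])
  obtain ⟨σ, hσ⟩ := Equiv.Perm.exists_extending_pair (Fin.castAdd l) f
    (Fin.castAdd_injective m l) hfi
  exact ⟨σ, funext fun i => by simp [hσ, hf]⟩

end PointConfig

variable {X : Type*} [MetricSpace X] [MeasurableSpace X] [BorelSpace X]
  [SecondCountableTopology X]

theorem bind_splitKernel_eq_zero_iff {r : ℕ} {Q : Measure (PointConfig X)}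
    {A : Set ((Fin r → X) × PointConfig X)} (hA : MeasurableSet A) :
    Q.bind (splitKernel X r) A = 0 ↔ ∀ᵐ ξ ∂Q, ∀ s ∈ tuples r ξ, (s, remove s ξ) ∉ A := by
  rw [Measure.bind_apply hA (Kernel.aemeasurable _),
    lintegral_eq_zero_iff (Kernel.measurable_coe _ hA)]
  simp_rw [← splitKernel_eq_zero_iff hA]
  rfl

theorem measurableSet_forall_tuples {r : ℕ} {A : Set ((Fin r → X) × PointConfig X)}
    (hA : MeasurableSet A) :
    MeasurableSet {ξ : PointConfig X | ∀ s ∈ tuples r ξ, (s, remove s ξ) ∉ A} := by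
  simp_rw [← splitKernel_eq_zero_iff hA]
  exact Kernel.measurable_coe _ hA (measurableSet_singleton _)

/-- Splitting off `m` points from a random configuration of `N` points in `D` whose law has the null
sets of the volume of a constraint set: as long as the statistics of these `m` points are
prescribed, their law and that of the remaining points are independent, up to null sets. -/
theorem exists_mutuallyAC_bind_splitKernel {μ : Measure X} {d : ℕ} (hμ : HasEuclideanCharts μ d)
    {D : Set X} (hD : MeasurableSet D) {t : ℕ} {Ψ : Fin t → X → ℂ} (hΨ : ∀ j, Measurable (Ψ j))
    {m : ℕ} {v : Fin t → ℂ} {G : Set (Fin m → X)} (hG : MeasurableSet G)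
    (hGv : G ⊆ constraintSet Ψ D m v) (hG0 : (Measure.pi fun _ => μ) G ≠ 0) {N p : ℕ}
    {s : Fin t → ℂ} (hσ : IsSigmaFiniteOn μH[p] (constraintSet Ψ D N s))
    {Q : Measure (PointConfig X)}
    (hQ : MutuallyAC Q ((μH[p].restrict (constraintSet Ψ D N s)).map ofVector))
    (hN : ∀ᵐ ξ ∂Q, ξ.carrier.encard = (N : ℕ∞)) :
    ∃ τ : Measure (PointConfig X), SFinite τ ∧
      MutuallyAC ((Q.bind (splitKernel X m)).restrict (G ×ˢ univ))
        (((Measure.pi fun _ => μ).restrict G).prod τ) := by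
  have := hμ.sigmaFinite
  have hS := measurableSet_constraintSet hΨ hD N s
  have hGu : MeasurableSet (G ×ˢ (univ : Set (PointConfig X))) := hG.prod .univ
  have hnull : ∀ A : Set ((Fin m → X) × PointConfig X), MeasurableSet A →
      ((Q.bind (splitKernel X m)).restrict (G ×ˢ univ) A = 0 ↔
        ∀ᵐ z ∂(μH[p] : Measure (Fin N → X)), z ∈ constraintSet Ψ D N s →
          ∀ s ∈ tuples m (ofVector z), (s, remove s (ofVector z)) ∉ A ∩ G ×ˢ univ) := fun A hA => by
    rw [Measure.restrict_apply hA, bind_splitKernel_eq_zero_iff (hA.inter hGu), hQ.ae_iff,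
      ae_map_iff (measurable_ofVector N).aemeasurable
        (measurableSet_forall_tuples (hA.inter hGu)), ae_restrict_iff' hS]
  -- A vector with coinciding coordinates would give fewer than N points.
  have hinj : ∀ᵐ z ∂(μH[p] : Measure (Fin N → X)), z ∈ constraintSet Ψ D N s →
      Function.Injective z := by
    rw [hQ.ae_iff] at hN
    have := ae_of_ae_map (measurable_ofVector N).aemeasurable hN
    rw [ae_restrict_iff' hS] at this
    filter_upwards [this] with z hz hzS using injective_of_encard_ofVector (hz hzS)
  -- Both degenerate cases, N < m and no admissible remainder, are settled by τ = 0.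
  have hzero : (∀ A : Set ((Fin m → X) × PointConfig X), MeasurableSet A →
      (Q.bind (splitKernel X m)).restrict (G ×ˢ univ) A = 0) → ∃ τ : Measure (PointConfig X),
      SFinite τ ∧ MutuallyAC ((Q.bind (splitKernel X m)).restrict (G ×ˢ univ))
        (((Measure.pi fun _ => μ).restrict G).prod τ) := fun h =>
    ⟨0, inferInstance, .of_forall fun A hA => by simp [h A hA]⟩
  rcases lt_or_ge N m with hlt | hle
  · exact hzero fun A hA => (hnull A hA).2 <| .of_forall fun z _ s hs =>
      absurd (le_of_mem_tuples_ofVector hs) (not_le.2 hlt)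
  obtain ⟨l, rfl⟩ := Nat.exists_eq_add_of_le hle
  let e := Fin.appendIsometry (α := X) m l
  -- Every m-tuple of points of z consists of the first m coordinates of some permutation of z.
  -- There are finitely many permutations, and the Hausdorff measure and the constraint set are
  -- invariant, so only the splitting into the first m and the last l coordinates has to be tested.
  have hnull' : ∀ A : Set ((Fin m → X) × PointConfig X), MeasurableSet A →
      ((Q.bind (splitKernel X m)).restrict (G ×ˢ univ) A = 0 ↔
        ∀ᵐ w ∂(μH[p] : Measure ((Fin m → X) × (Fin l → X))),
          w ∈ G ×ˢ constraintSet Ψ D l (s - v) → (w.1, ofVector w.2) ∉ A) := fun A hA => by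
    rw [hnull A hA]
    trans ∀ᵐ z ∂(μH[p] : Measure (Fin (m + l) → X)), z ∈ constraintSet Ψ D (m + l) s →
      (z ∘ Fin.castAdd l, ofVector (z ∘ Fin.natAdd m)) ∉ A ∩ G ×ˢ univ
    · constructor
      · intro h
        filter_upwards [h, hinj] with z hz hzi hzS
        have := hz hzS (z ∘ Fin.castAdd l) ⟨(hzi hzS).comp (Fin.castAdd_injective m l),
          fun i => ⟨_, rfl⟩⟩
        rwa [remove_ofVector_castAdd (hzi hzS)] at this
      · intro h
        have h' : ∀ᵐ z ∂(μH[p] : Measure (Fin (m + l) → X)), ∀ σ : Equiv.Perm (Fin (m + l)),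
            z ∘ σ ∈ constraintSet Ψ D (m + l) s →
            ((z ∘ σ) ∘ Fin.castAdd l, ofVector ((z ∘ σ) ∘ Fin.natAdd m)) ∉ A ∩ G ×ˢ univ :=
          ae_all_iff.2 fun σ => ae_hausdorffMeasure_comp_perm σ h
        filter_upwards [h', hinj] with z hz hzi hzS s hs
        obtain ⟨σ, rfl⟩ := exists_perm_of_mem_tuples hs
        have := hz σ (comp_perm_mem_constraintSet σ hzS)
        rwa [← remove_ofVector_castAdd ((hzi hzS).comp σ.injective), ofVector_comp_perm] at this
    · rw [ae_iff, ae_iff, ← e.hausdorffMeasure_preimage]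
      refine Eq.congr (congrArg _ ?_) rfl
      ext w
      have h1 : (e w) ∘ Fin.castAdd l = w.1 := funext fun i => Fin.append_left _ _ i
      have h2 : (e w) ∘ Fin.natAdd m = w.2 := funext fun i => Fin.append_right _ _ i
      simp only [mem_preimage, mem_ofPred_eq, h1, h2, mem_prod, mem_inter_iff, mem_univ, and_true,
        Classical.not_imp, not_not]
      have h3 : w.1 ∈ G → (e w ∈ constraintSet Ψ D (m + l) s ↔
          w.2 ∈ constraintSet Ψ D l (s - v)) := fun hw => append_mem_constraintSet (hGv hw)
      tauto
  have hT := measurableSet_constraintSet hΨ hD l (s - v)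
  rcases (constraintSet Ψ D l (s - v)).eq_empty_or_nonempty with hT0 | hT0
  · exact hzero fun A hA => (hnull' A hA).2 <| .of_forall fun w hw => by simp [hT0] at hw
  obtain ⟨𝒰, hc, hcov, hgr, hprod⟩ := hμ.exists_cover_pi m (Fin l → X)
  obtain ⟨c, hc1, hc2⟩ := hσ
  obtain ⟨-, hfin, hmac⟩ := hausdorffMeasure_restrict_prod_mutuallyAC (by positivity) hc hcov hgr
    hprod hG hG0 hT hT0 (p := p) (s := fun n => e ⁻¹' c n)
    (fun w hw => by
      rw [← preimage_iUnion]
      exact hc1 ((append_mem_constraintSet (hGv hw.1)).2 hw.2))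
    (fun n => by rw [e.hausdorffMeasure_preimage]; exact hc2 n)
  refine ⟨_, inferInstance, MutuallyAC.of_forall (ν := ((Measure.pi fun _ => μ).restrict G).prod
    ((μH[p - (m * d : ℕ)].restrict (constraintSet Ψ D l (s - v))).map ofVector)) fun A hA => ?_⟩
  rw [hnull' A hA, ← ae_restrict_iff' (hG.prod hT), hmac.ae_iff, ← Measure.map_id (μ :=
    (Measure.pi fun _ => μ).restrict G), Measure.map_prod_map _ _ measurable_id
    (measurable_ofVector l), Measure.map_apply (measurable_id.prodMap (measurable_ofVector l)) hA,
    Measure.map_id, ae_iff]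
  simp only [not_not]
  rfl

end Fiber

/-! ### Mixtures of product measures. -/

section CompProd
variable {α β γ : Type*} [MeasurableSpace α] [MeasurableSpace β] [MeasurableSpace γ]

theorem compProd_restrict_prod_univ (μ : Measure α) [SFinite μ] (κ : Kernel α β)
    [IsSFiniteKernel κ] {G : Set α} (hG : MeasurableSet G) :
    (μ ⊗ₘ κ).restrict (G ×ˢ univ) = (μ.restrict G) ⊗ₘ κ := by
  ext A hA
  rw [Measure.restrict_apply hA, Measure.compProd_apply (hA.inter (hG.prod .univ)),
    Measure.compProd_apply hA, ← lintegral_indicator hG]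
  refine lintegral_congr fun x => ?_
  by_cases hx : x ∈ G
  · rw [indicator_of_mem hx]
    congr 1
    ext y; simp [hx]
  · rw [indicator_of_notMem hx, ← measure_empty (μ := κ x)]
    congr 1
    ext y; simp [hx]

/-- Mixing measures with the null sets of products `μ × τ η` over `η`, and moving the second
coordinate along, gives a measure with the null sets of a product with `μ`. -/
theorem exists_mutuallyAC_map_compProd {ν : Measure γ} [SFinite ν] {L : Kernel γ (α × β)}
    [IsSFiniteKernel L] {μ : Measure α} [SFinite μ] {g : γ × β → β} (hg : Measurable g)
    (h : ∀ᵐ c ∂ν, ∃ τ : Measure β, SFinite τ ∧ MutuallyAC (L c) (μ.prod τ)) :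
    ∃ τ : Measure β, SFinite τ ∧
      MutuallyAC ((ν ⊗ₘ L).map fun q => (q.2.1, g (q.1, q.2.2))) (μ.prod τ) := by
  have hm : Measurable fun q : γ × α × β => (q.2.1, g (q.1, q.2.2)) :=
    (measurable_fst.comp measurable_snd).prodMk
      (hg.comp (measurable_fst.prodMk (measurable_snd.comp measurable_snd)))
  -- The given τ is chosen for each c with no measurability in c. The second marginal of L c has the
  -- same role and is a kernel.
  have h1 : ∀ᵐ c ∂ν, MutuallyAC (L c) ((Kernel.const γ μ ×ₖ L.snd) c) := by
    filter_upwards [h] with c ⟨τ, _, hτ⟩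
    rw [Kernel.prod_apply, Kernel.const_apply, Kernel.snd_apply]
    exact hτ.prod_snd
  have h2 : MutuallyAC (ν ⊗ₘ L) (ν ⊗ₘ (Kernel.const γ μ ×ₖ L.snd)) :=
    ⟨.compProd_right (h1.mono fun _ h => h.1), .compProd_right (h1.mono fun _ h => h.2)⟩
  refine ⟨(ν ⊗ₘ L.snd).map g, inferInstance, (h2.map hm).trans ?_⟩
  suffices (ν ⊗ₘ (Kernel.const γ μ ×ₖ L.snd)).map (fun q => (q.2.1, g (q.1, q.2.2))) =
      μ.prod ((ν ⊗ₘ L.snd).map g) by rw [this]; exact .refl _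
  ext A hA
  rw [Measure.map_apply hm hA, Measure.compProd_apply (hm hA), Measure.prod_apply_symm hA,
    lintegral_map (measurable_measure_prodMk_right hA) hg,
    Measure.lintegral_compProd (f := fun q => μ ((fun x => (x, g q)) ⁻¹' A))
      ((measurable_measure_prodMk_right hA).comp hg)]
  refine lintegral_congr fun c => ?_
  rw [Kernel.prod_apply, Kernel.const_apply,
    Measure.prod_apply_symm (measurable_prodMk_left (hm hA))]
  rfl

end CompProd

namespace PointConfig
variable {X : Type*} [MetricSpace X]

theorem mem_tuples_restrict {r : ℕ} {D : Set X} {ξ : PointConfig X} {s : Fin r → X}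
    (hs : ∀ i, s i ∈ D) : s ∈ tuples r (ξ.restrict D) ↔ s ∈ tuples r ξ := by
  simp [tuples, PointConfig.restrict, hs]

theorem glue_remove_restrict {r : ℕ} {D : Set X} (ξ : PointConfig X) {s : Fin r → X}
    (hs : ∀ i, s i ∈ D) : glue D (ξ.restrict Dᶜ) (remove s (ξ.restrict D)) = remove s ξ := by
  ext1
  have : range s ⊆ D := range_subset_iff.2 hs
  ext x
  simp only [glue, remove, PointConfig.restrict, mem_union, mem_inter_iff, mem_compl_iff]
  have := @this x
  tauto

end PointConfig

/-! ### The reduced Campbell measure and the reduced Palm measures. -/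

section ReducedCampbell
open Measure PointConfig

variable {X : Type*} [MetricSpace X] [MeasurableSpace X] [BorelSpace X]
  [SecondCountableTopology X]

/-- A tuple in D affects the inside only: removing it from the inside and gluing the outside back
gives ξ ∖ s. -/
theorem splitKernel_apply_restrict {r : ℕ} {D : Set X} (hD : MeasurableSet D)
    {G : Set (Fin r → X)} (hG : MeasurableSet G) (hGD : ∀ s ∈ G, ∀ i, s i ∈ D) (ξ : PointConfig X)
    {A : Set ((Fin r → X) × PointConfig X)} (hA : MeasurableSet A) :
    splitKernel X r ξ (A ∩ G ×ˢ univ) = splitKernel X r (ξ.restrict D)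
      {q | (q.1, glue D (ξ.restrict Dᶜ) q.2) ∈ A ∧ q.1 ∈ G} := by
  have hm : Measurable fun q : (Fin r → X) × PointConfig X => (q.1, glue D (ξ.restrict Dᶜ) q.2) :=
    measurable_fst.prodMk ((measurable_glue hD).comp (measurable_const.prodMk measurable_snd))
  have hB : MeasurableSet {q : (Fin r → X) × PointConfig X |
      (q.1, glue D (ξ.restrict Dᶜ) q.2) ∈ A ∧ q.1 ∈ G} := (hm hA).inter (measurable_fst hG)
  rw [splitKernel_apply r ξ (hA.inter (hG.prod .univ)), splitKernel_apply _ _ hB,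
    factorialMeasure_apply _ _ (measurableSet_remove_mem ξ (hA.inter (hG.prod .univ))),
    factorialMeasure_apply _ _ (measurableSet_remove_mem _ hB)]
  congr 2
  ext s
  by_cases hs : s ∈ G
  · simp [hs, mem_tuples_restrict (hGD s hs), glue_remove_restrict ξ (hGD s hs)]
  · simp [hs]

theorem bind_splitKernel_restrict_eq {P : Measure (PointConfig X)} [SFinite P] {D : Set X}
    (hD : MeasurableSet D) {κ : Kernel (PointConfig X) (PointConfig X)} [IsSFiniteKernel κ]
    (hκ : P.map (fun ξ => (ξ.restrict Dᶜ, ξ.restrict D)) =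
      (P.map (PointConfig.restrict Dᶜ)) ⊗ₘ κ) {m : ℕ} {G : Set (Fin m → X)}
    (hG : MeasurableSet G) (hGD : ∀ s ∈ G, ∀ i, s i ∈ D) :
    (P.bind (splitKernel X m)).restrict (G ×ˢ univ) =
      ((P.map (PointConfig.restrict Dᶜ)) ⊗ₘ
        ((splitKernel X m ∘ₖ κ).restrict (hG.prod MeasurableSet.univ))).map
        fun q => (q.2.1, glue D q.1 q.2.2) := by
  have hm : Measurable fun q : PointConfig X × (Fin m → X) × PointConfig X =>
      (q.2.1, glue D q.1 q.2.2) := (measurable_fst.comp measurable_snd).prodMk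
      ((measurable_glue hD).comp (measurable_fst.prodMk (measurable_snd.comp measurable_snd)))
  ext A hA
  have hB : MeasurableSet {q : PointConfig X × (Fin m → X) × PointConfig X |
      (q.2.1, glue D q.1 q.2.2) ∈ A ∧ q.2.1 ∈ G} :=
    (hm hA).inter ((measurable_fst.comp measurable_snd) hG)
  have hF : Measurable fun q : PointConfig X × PointConfig X => splitKernel X m q.2
      {w | (w.1, glue D q.1 w.2) ∈ A ∧ w.1 ∈ G} := by
    have h1 : MeasurableSet {q : (PointConfig X × PointConfig X) × (Fin m → X) × PointConfig X |
        (q.2.1, glue D q.1.1 q.2.2) ∈ A ∧ q.2.1 ∈ G} :=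
      ((measurable_fst.comp measurable_fst).prodMk measurable_snd) hB
    exact Kernel.measurable_kernel_prodMk_left (κ := Kernel.prodMkLeft _ (splitKernel X m)) h1
  have hr : Measurable fun ξ : PointConfig X => (ξ.restrict Dᶜ, ξ.restrict D) :=
    (measurable_restrict hD.compl).prodMk (measurable_restrict hD)
  rw [Measure.restrict_apply hA, Measure.bind_apply (hA.inter (hG.prod .univ))
    (Kernel.aemeasurable _), Measure.map_apply hm hA, Measure.compProd_apply (hm hA)]
  simp_rw [splitKernel_apply_restrict hD hG hGD _ hA]
  rw [← lintegral_map (f := fun q : PointConfig X × PointConfig X => splitKernel X m q.2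
      {w | (w.1, glue D q.1 w.2) ∈ A ∧ w.1 ∈ G}) hF hr, hκ, Measure.lintegral_compProd hF]
  refine lintegral_congr fun η => ?_
  rw [Kernel.restrict_apply, Measure.restrict_apply (measurable_prodMk_left (hm hA)),
    Kernel.comp_apply' _ _ _ ((measurable_prodMk_left (hm hA)).inter (hG.prod .univ))]
  refine lintegral_congr fun ξ => ?_
  congr 1
  ext w
  simp

/-- The reduced Campbell measure of a tolerant process: where the statistics of the tuple are
prescribed, it has the null sets of a product measure. -/
theorem exists_mutuallyAC_bind_splitKernel_of_condDistrib {μ : Measure X} {d : ℕ}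
    (hμ : HasEuclideanCharts μ d) {P : Measure (PointConfig X)} [SFinite P] {D : Set X}
    (hD : MeasurableSet D) {κ : Kernel (PointConfig X) (PointConfig X)} [IsSFiniteKernel κ]
    (hκ : P.map (fun ξ => (ξ.restrict Dᶜ, ξ.restrict D)) =
      (P.map (PointConfig.restrict Dᶜ)) ⊗ₘ κ) {t : ℕ} {Ψ : Fin t → X → ℂ}
    (hΨ : ∀ j, Measurable (Ψ j)) {m : ℕ} {v : Fin t → ℂ} {G : Set (Fin m → X)}
    (hG : MeasurableSet G) (hGv : G ⊆ constraintSet Ψ D m v)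
    (hG0 : (Measure.pi fun _ => μ) G ≠ 0)
    (h : ∀ᵐ η ∂(P.map (PointConfig.restrict Dᶜ)), ∃ (N p : ℕ) (s : Fin t → ℂ),
      IsSigmaFiniteOn μH[p] (constraintSet Ψ D N s) ∧
      MutuallyAC (κ η) ((μH[p].restrict (constraintSet Ψ D N s)).map ofVector) ∧
      ∀ᵐ ξ ∂(κ η), ξ.carrier.encard = (N : ℕ∞)) :
    ∃ τ : Measure (PointConfig X), SFinite τ ∧
      MutuallyAC ((P.bind (splitKernel X m)).restrict (G ×ˢ univ))
        (((Measure.pi fun _ => μ).restrict G).prod τ) := by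
  have := hμ.sigmaFinite
  rw [bind_splitKernel_restrict_eq hD hκ hG fun s hs => (hGv hs).1]
  refine exists_mutuallyAC_map_compProd (g := fun q => glue D q.1 q.2) (measurable_glue hD) ?_
  filter_upwards [h] with η ⟨N, p, s, h1, h2, h3⟩
  rw [Kernel.restrict_apply, Kernel.comp_apply]
  exact exists_mutuallyAC_bind_splitKernel hμ hD hΨ hG hGv hG0 h1 h2 h3

/-- The reduced Palm measures as a kernel. -/
def reducedPalmKernel {r : ℕ} (Q : Kernel (Fin r → X) (PointConfig X)) :
    Kernel (Fin r → X) (PointConfig X) :=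
  (Kernel.id ×ₖ Q).map fun q => remove q.1 q.2

theorem reducedPalmKernel_apply {r : ℕ} (Q : Kernel (Fin r → X) (PointConfig X))
    [IsSFiniteKernel Q] (ζ : Fin r → X) : reducedPalmKernel Q ζ = reducedPalm Q ζ := by
  rw [reducedPalmKernel, Kernel.map_apply _ (measurable_remove r), Kernel.prod_apply,
    Kernel.id_apply, Measure.dirac_prod, Measure.map_map (measurable_remove r)
      measurable_prodMk_left]
  rfl

instance {r : ℕ} (Q : Kernel (Fin r → X) (PointConfig X)) [IsMarkovKernel Q] :
    IsMarkovKernel (reducedPalmKernel Q) :=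
  Kernel.IsMarkovKernel.map _ (measurable_remove r)

/-- Push the disintegration of the Campbell measure forward under (s, ξ) ↦ (s, ξ ∖ s). -/
theorem IsPalmFamily.bind_splitKernel_eq {P : Measure (PointConfig X)} [SFinite P] {r : ℕ}
    {Q : Kernel (Fin r → X) (PointConfig X)} (h : IsPalmFamily P r Q)
    [SFinite (intensityMeasure P r)] :
    P.bind (splitKernel X r) = intensityMeasure P r ⊗ₘ reducedPalmKernel Q := by
  obtain ⟨_, h⟩ := h
  have hm : Measurable fun q : (Fin r → X) × PointConfig X => (q.1, remove q.1 q.2) :=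
    measurable_fst.prodMk (measurable_remove r)
  rw [campbellMeasure_eq] at h
  have h' := congrArg (Measure.map fun q => (q.1, remove q.1 q.2)) h
  rw [Measure.map_map hm measurable_swap] at h'
  ext A hA
  have h1 := congrArg (fun μ : Measure _ => μ A) h'
  rw [Measure.map_apply (hm.comp measurable_swap) hA, Measure.map_apply hm hA,
    Measure.compProd_apply ((hm.comp measurable_swap) hA), Measure.compProd_apply (hm hA)] at h1
  rw [Measure.bind_apply hA (Kernel.aemeasurable _), Measure.compProd_apply hA]
  simp_rw [splitKernel_apply r _ hA]
  refine h1.trans (lintegral_congr fun ζ => ?_)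
  rw [reducedPalmKernel_apply, reducedPalm]
  exact (Measure.map_apply (measurable_restrict (finite_range ζ).measurableSet.compl)
    (measurable_prodMk_left hA)).symm

/-- If the reduced Campbell measure has the null sets of a product measure over `G`, then almost
all the reduced Palm measures over `G` have the null sets of its second factor. -/
theorem IsPalmFamily.ae_mutuallyAC_reducedPalm {P : Measure (PointConfig X)} [SFinite P] {r : ℕ}
    {Q : Kernel (Fin r → X) (PointConfig X)} (h : IsPalmFamily P r Q) {ν : Measure (Fin r → X)}
    [SigmaFinite ν] [SigmaFinite (intensityMeasure P r)] (hν : intensityMeasure P r ≪ ν)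
    {G : Set (Fin r → X)} (hG : MeasurableSet G)
    (hG0 : ∀ ζ ∈ G, (intensityMeasure P r).rnDeriv ν ζ ≠ 0) {τ : Measure (PointConfig X)}
    [SFinite τ] (hτ : MutuallyAC ((P.bind (splitKernel X r)).restrict (G ×ˢ univ))
      ((ν.restrict G).prod τ)) :
    ∀ᵐ ζ ∂(ν.restrict G), MutuallyAC (reducedPalm Q ζ) τ := by
  have hQ := h.1
  rw [h.bind_splitKernel_eq, compProd_restrict_prod_univ _ _ hG] at hτ
  -- On G the density of the intensity measure does not vanish.
  have h1 : MutuallyAC ((intensityMeasure P r).restrict G) (ν.restrict G) := by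
    refine ⟨hν.restrict G, ?_⟩
    rw [← Measure.withDensity_rnDeriv_eq _ _ hν, restrict_withDensity hG]
    refine withDensity_absolutelyContinuous' (measurable_rnDeriv _ _).aemeasurable ?_
    rw [ae_restrict_iff' hG]
    exact .of_forall hG0
  -- τ is only s-finite. An equivalent finite measure gives a finite constant kernel, so that
  -- equivalence can be compared fibre by fibre.
  have h2 : MutuallyAC (τ : Measure (PointConfig X)) τ.toFinite :=
    ⟨absolutelyContinuous_toFinite τ, toFinite_absolutelyContinuous τ⟩
  have h3 : MutuallyAC ((ν.restrict G) ⊗ₘ reducedPalmKernel Q)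
      ((ν.restrict G) ⊗ₘ Kernel.const _ τ.toFinite) := by
    rw [Measure.compProd_const]
    exact .trans ⟨h1.2.compProd_left _, h1.1.compProd_left _⟩ (hτ.trans (.prod (.refl _) h2))
  filter_upwards [h3.1.kernel_of_compProd, h3.2.kernel_of_compProd] with ζ ha hb
  rw [reducedPalmKernel_apply, Kernel.const_apply] at ha hb
  exact MutuallyAC.trans ⟨ha, hb⟩ h2.symm

end ReducedCampbell

/-! ### Rigid statistics under Palm measures, and singularity. -/

section PalmStatistics
open Measure PointConfig

variable {X : Type*} [MetricSpace X] [MeasurableSpace X] [BorelSpace X]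
  [SecondCountableTopology X]

theorem setIntegral_count_of_finite {F : Set X} (hF : F.Finite) (φ : X → ℂ) :
    ∫ x in F, φ x ∂Measure.count = ∑ᶠ x ∈ F, φ x := by
  lift F to Finset X using hF
  rw [setIntegral_finset, finsum_mem_coe_finset]
  · simp
  · have : IsFiniteMeasure (Measure.count.restrict (F : Set X)) := ⟨by simp⟩
    rw [IntegrableOn, ← Measure.restrict_restrict_of_subset (Subset.refl (F : Set X))]
    exact IntegrableOn.finset (μ := Measure.count.restrict (F : Set X)) (s := F) (f := φ)

theorem linearStatistic_restrict_eq_add (φ : X → ℂ) {D : Set X} (hD : Bornology.IsBounded D)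
    {r : ℕ} {ξ : PointConfig X} {s : Fin r → X} (hs : s ∈ tuples r ξ) (hsD : ∀ i, s i ∈ D) :
    linearStatistic φ (ξ.restrict D).countingMeasure =
      linearStatistic φ ((remove s ξ).restrict D).countingMeasure +
        linearStatistic φ (vectorMeasure s) := by
  have hfin := ξ.finite_inter D hD
  have h1 : ξ.carrier ∩ D = (ξ.carrier ∩ (range s)ᶜ ∩ D) ∪ range s := by
    have h2 : range s ⊆ ξ.carrier := range_subset_iff.2 hs.2
    have h3 : range s ⊆ D := range_subset_iff.2 hsD
    ext x
    have := @h2 x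
    have := @h3 x
    simp only [mem_inter_iff, mem_union, mem_compl_iff]
    tauto
  have h4 : (ξ.carrier ∩ (range s)ᶜ ∩ D).Finite := hfin.subset fun x hx => ⟨hx.1.1, hx.2⟩
  rw [linearStatistic_vectorMeasure]
  change ∫ x in ξ.carrier ∩ D, φ x ∂Measure.count =
    ∫ x in ξ.carrier ∩ (range s)ᶜ ∩ D, φ x ∂Measure.count + _
  rw [setIntegral_count_of_finite hfin, setIntegral_count_of_finite h4, h1,
    finsum_mem_union (disjoint_left.2 fun x hx hx' => hx.1.2 hx') h4 (finite_range s),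
    finsum_mem_range hs.1]
  exact congrArg _ (finsum_eq_sum_of_fintype _)

/-- Under the reduced Palm measure at `ζ` the difference between a rigid statistic and the function
of the outside that predicts it is, almost surely, the statistic of `ζ`. -/
theorem IsPalmFamily.ae_statistic_eq {P : Measure (PointConfig X)} [SFinite P] {r : ℕ}
    {Q : Kernel (Fin r → X) (PointConfig X)} (h : IsPalmFamily P r Q)
    [SFinite (intensityMeasure P r)] {D : Set X} (hD : MeasurableSet D)
    (hDb : Bornology.IsBounded D) {φ : X → ℂ} (hφ : Measurable φ) {f : PointConfig X → ℂ}
    (hf : Measurable f)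
    (hrig : ∀ᵐ ξ ∂P, linearStatistic φ (ξ.restrict D).countingMeasure = f (ξ.restrict Dᶜ)) :
    ∀ᵐ ζ ∂(intensityMeasure P r), (∀ i, ζ i ∈ D) → ∀ᵐ ξ ∂(reducedPalm Q ζ),
      f (ξ.restrict Dᶜ) - linearStatistic φ (ξ.restrict D).countingMeasure =
        linearStatistic φ (vectorMeasure ζ) := by
  have hQ := h.1
  have hA : MeasurableSet {q : (Fin r → X) × PointConfig X | ¬ ((∀ i, q.1 i ∈ D) →
      f (q.2.restrict Dᶜ) - linearStatistic φ (q.2.restrict D).countingMeasure =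
        linearStatistic φ (vectorMeasure q.1))} := by
    have h1 : MeasurableSet {q : (Fin r → X) × PointConfig X | ∀ i, q.1 i ∈ D} := by
      simp_rw [ofPred_forall]
      exact .iInter fun i => ((measurable_pi_apply i).comp measurable_fst) hD
    have h2 : MeasurableSet {q : (Fin r → X) × PointConfig X |
        f (q.2.restrict Dᶜ) - linearStatistic φ (q.2.restrict D).countingMeasure =
          linearStatistic φ (vectorMeasure q.1)} :=
      measurableSet_eq_fun (((hf.comp (measurable_restrict hD.compl)).sub
        (measurable_linearStatistic_restrict hφ hD)).comp measurable_snd)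
        ((measurable_linearStatistic_vectorMeasure hφ).comp measurable_fst)
    exact (h1.imp h2).compl
  have h0 : P.bind (splitKernel X r) _ = 0 := (bind_splitKernel_eq_zero_iff hA).2 <| by
    filter_upwards [hrig] with ξ hξ s hs
    -- Since s lies in D, the outside and hence the value of f are unchanged, while the inside
    -- statistic drops by that of s.
    refine not_not.2 fun hsD => ?_
    have : (remove s ξ).restrict Dᶜ = ξ.restrict Dᶜ := by
      ext x
      have : x ∈ range s → x ∈ D := fun ⟨i, hi⟩ => hi ▸ hsD i
      simp only [remove, PointConfig.restrict, mem_inter_iff, mem_compl_iff]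
      tauto
    rw [this, ← hξ, linearStatistic_restrict_eq_add φ hDb hs hsD, add_sub_cancel_left]
  rw [h.bind_splitKernel_eq] at h0
  filter_upwards [ae_ae_of_ae_compProd (compl_mem_ae_iff.2 h0)] with ζ hζ hζD
  rw [reducedPalmKernel_apply] at hζ
  filter_upwards [hζ] with ξ hξ
  by_contra hne
  exact hξ fun H => hne (H hζD)

theorem mutuallySingular_of_ae_eq {Ω β : Type*} [MeasurableSpace Ω] [MeasurableSpace β]
    [MeasurableSingletonClass β] {μ ν : Measure Ω} {f : Ω → β} (hf : Measurable f) {a b : β}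
    (hab : a ≠ b) (hμ : ∀ᵐ x ∂μ, f x = a) (hν : ∀ᵐ x ∂ν, f x = b) : μ ⟂ₘ ν :=
  ⟨f ⁻¹' {a}ᶜ, hf (measurableSet_singleton a).compl, hμ, by
    rw [← preimage_compl, compl_compl]
    exact measure_mono_null (fun x (hx : f x = a) (hx' : f x = b) => hab (hx.symm.trans hx')) hν⟩

theorem ae_rnDeriv_ne_zero {α : Type*} [MeasurableSpace α] {ρ ν : Measure α} [SigmaFinite ρ]
    [SigmaFinite ν] (h : ρ ≪ ν) {q : α → Prop} (hq : ∀ᵐ x ∂ρ, q x) :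
    ∀ᵐ x ∂ν, ρ.rnDeriv ν x ≠ 0 → q x := by
  rw [← ae_withDensity_iff (measurable_rnDeriv ρ ν), withDensity_rnDeriv_eq _ _ h]
  exact hq

theorem ae_mutuallySingular_reducedPalm {P : Measure (PointConfig X)} [SFinite P]
    {μ : Measure X} [SigmaFinite μ] {k : ℕ} {Φ : Fin k → X → ℂ} (hΦ : ∀ i, Measurable (Φ i))
    (hrigid : ∀ D : Set X, IsOpen D → Bornology.IsBounded D → ∀ i, IsRigidStatistic P D (Φ i))
    {m n : ℕ} [SigmaFinite (intensityMeasure P m)] [SigmaFinite (intensityMeasure P n)]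
    (hm : intensityMeasure P m ≪ Measure.pi fun _ => μ)
    (hn : intensityMeasure P n ≪ Measure.pi fun _ => μ)
    {Q₁ : Kernel (Fin m → X) (PointConfig X)} (hQ₁ : IsPalmFamily P m Q₁)
    {Q₂ : Kernel (Fin n → X) (PointConfig X)} (hQ₂ : IsPalmFamily P n Q₂) :
    ∀ᵐ ζ ∂((Measure.pi fun _ : Fin m => μ).prod (Measure.pi fun _ : Fin n => μ)),
      (intensityMeasure P m).rnDeriv (Measure.pi fun _ => μ) ζ.1 ≠ 0 →
      (intensityMeasure P n).rnDeriv (Measure.pi fun _ => μ) ζ.2 ≠ 0 →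
      (¬ ∀ i, linearStatistic (Φ i) (vectorMeasure ζ.1) =
            linearStatistic (Φ i) (vectorMeasure ζ.2)) →
        reducedPalm Q₁ ζ.1 ⟂ₘ reducedPalm Q₂ ζ.2 := by
  obtain ⟨B, hBm, hBo, hb, hcov⟩ := exists_cover_isOpen_isBounded X
  choose f hf hrig using fun R => hrigid (B R) (hBo R) (hb R)
  have key : ∀ (r : ℕ) [SigmaFinite (intensityMeasure P r)] (_ : intensityMeasure P r ≪
      Measure.pi fun _ => μ) {Q : Kernel (Fin r → X) (PointConfig X)} (_ : IsPalmFamily P r Q),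
      ∀ᵐ ζ ∂(Measure.pi fun _ : Fin r => μ),
        (intensityMeasure P r).rnDeriv (Measure.pi fun _ => μ) ζ ≠ 0 →
        ∃ R₀, ∀ R ≥ R₀, ∀ i, ∀ᵐ ξ ∂(reducedPalm Q ζ), f R i (ξ.restrict (B R)ᶜ) -
          linearStatistic (Φ i) (ξ.restrict (B R)).countingMeasure =
            linearStatistic (Φ i) (vectorMeasure ζ) := fun r _ hr Q hQ => by
    have h1 := ae_rnDeriv_ne_zero hr (ae_all_iff.2 fun R => ae_all_iff.2 fun i =>
      hQ.ae_statistic_eq (hBo R).measurableSet (hb R) (hΦ i) (hf R i) (hrig R i))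
    filter_upwards [h1] with ζ hζ hζ0
    choose N hN using fun i => mem_iUnion.1 (hcov.symm ▸ mem_univ (ζ i))
    exact ⟨Finset.univ.sup N, fun R hR i => hζ hζ0 R i fun j =>
      hBm ((Finset.le_sup (Finset.mem_univ j)).trans hR) (hN j)⟩
  filter_upwards [quasiMeasurePreserving_fst.ae (key m hm hQ₁),
    quasiMeasurePreserving_snd.ae (key n hn hQ₂)] with ζ h1 h2 h01 h02 hne
  obtain ⟨R₁, h1⟩ := h1 h01
  obtain ⟨R₂, h2⟩ := h2 h02
  obtain ⟨i, hi⟩ := not_forall.1 hne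
  -- The two measures must be separated by one function, so one window is taken that works for both
  -- vectors.
  have hB := (hBo (max R₁ R₂)).measurableSet
  exact mutuallySingular_of_ae_eq (((hf _ i).comp (measurable_restrict hB.compl)).sub
    (measurable_linearStatistic_restrict (hΦ i) hB)) hi
    (h1 _ (le_max_left _ _) i) (h2 _ (le_max_right _ _) i)

/-- For almost every pair on which a measurable map takes equal values, this value is an atom. -/
theorem ae_prod_eq_imp_pos {α β : Type*} [MeasurableSpace α] [MeasurableSpace β]
    [MeasurableEq β] [MeasurableSingletonClass β] {ν : Measure α} [SFinite ν]
    {f : α → β} (hf : Measurable f) :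
    ∀ᵐ x ∂(ν.prod ν), f x.1 = f x.2 → 0 < ν (f ⁻¹' {f x.1}) := by
  have hc : {b | 0 < ν (f ⁻¹' {b})}.Countable := countable_meas_pos_of_disjoint_iUnion
    (fun b => hf (measurableSet_singleton b)) fun a b hab =>
      Disjoint.preimage f (disjoint_singleton.2 hab)
  have hm : MeasurableSet {x : α × α | ¬ (f x.1 = f x.2 → 0 < ν (f ⁻¹' {f x.1}))} :=
    ((measurableSet_eq_fun (hf.comp measurable_fst) (hf.comp measurable_snd)).imp
      ((hf.comp measurable_fst) hc.measurableSet)).compl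
  rw [ae_iff, measure_prod_null hm]
  refine .of_forall fun x => ?_
  -- For fixed x, a bad y lies in the fibre of f through x, and is bad only when this fibre is null.
  by_cases hx : ν (f ⁻¹' {f x}) = 0
  · refine measure_mono_null (fun y hy => ?_) hx
    exact (Classical.not_imp.1 hy).1.symm
  · have : Prod.mk x ⁻¹' {x : α × α | ¬ (f x.1 = f x.2 → 0 < ν (f ⁻¹' {f x.1}))} = ∅ :=
      eq_empty_of_forall_notMem fun y hy => (Classical.not_imp.1 hy).2 (pos_iff_ne_zero.2 hx)
    exact (congrArg ν this).trans measure_empty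

end PalmStatistics

/-! ### Consequences of tolerance: equivalence of Palm measures. -/

section Tolerance
open Measure PointConfig

variable {E : Type*} [NormedAddCommGroup E] [NormedSpace ℝ E] [FiniteDimensional ℝ E]
  {M : Type*} [MetricSpace M] [SecondCountableTopology M] [ChartedSpace E M]
  [Bundle.RiemannianBundle (fun x : M => TangentSpace 𝓘(ℝ, E) x)]
  [IsManifold 𝓘(ℝ, E) 1 M] [IsContinuousRiemannianBundle E (fun x : M => TangentSpace 𝓘(ℝ, E) x)]
  [IsRiemannianManifold 𝓘(ℝ, E) M] [MeasurableSpace M] [BorelSpace M]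

theorem IsTolerant.exists_mutuallyAC_bind_splitKernel {P : Measure (PointConfig M)} [SFinite P]
    {D : Set M} (hD : MeasurableSet D) (hDb : Bornology.IsBounded D) {k : ℕ} {Φ : Fin (k + 1) → M → ℂ}
    (hΦ : ∀ i, Measurable (Φ i)) (hΦ₀ : ∀ x, Φ 0 x = 1) (htol : IsTolerant E P D Φ) {m : ℕ}
    {v : Fin k → ℂ} {G : Set (Fin m → M)} (hG : MeasurableSet G)
    (hGv : G ⊆ constraintSet (fun j => Φ j.succ) D m v)
    (hG0 : (Measure.pi fun _ => riemannianVolume E M) G ≠ 0) :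
    ∃ τ : Measure (PointConfig M), SFinite τ ∧
      MutuallyAC ((P.bind (splitKernel M m)).restrict (G ×ˢ univ))
        (((Measure.pi fun _ => riemannianVolume E M).restrict G).prod τ) := by
  obtain ⟨s, κ, hs, hst, _, hκ, hη⟩ := htol
  refine exists_mutuallyAC_bind_splitKernel_of_condDistrib
    (hasEuclideanCharts_riemannianVolume E M) hD hκ (fun j => hΦ j.succ) hG hGv hG0 ?_
  -- The statistic of the constant function 1 is the number of points inside, and this moves from P
  -- to almost every κ η. Finiteness is recorded as well, since `toReal` sends an infinite count to
  -- 0.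
  have hcount : ∀ᵐ q ∂((P.map (PointConfig.restrict Dᶜ)) ⊗ₘ κ),
      (((q.2.countingMeasure univ).toReal : ℝ) : ℂ) = s 0 q.1 ∧ q.2.countingMeasure univ ≠ ⊤ := by
    have hm : MeasurableSet {q : PointConfig M × PointConfig M |
        (((q.2.countingMeasure univ).toReal : ℝ) : ℂ) = s 0 q.1 ∧
          q.2.countingMeasure univ ≠ ⊤} := by
      have h1 : Measurable fun q : PointConfig M × PointConfig M => q.2.countingMeasure univ :=
        (measurable_countingMeasure_apply .univ).comp measurable_snd
      exact (measurableSet_eq_fun (Complex.measurable_ofReal.comp h1.ennreal_toReal)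
        ((hs 0).comp measurable_fst)).inter (h1 (measurableSet_singleton ⊤).compl)
    rw [← hκ, ae_map_iff ((measurable_restrict hD.compl).prodMk
      (measurable_restrict hD)).aemeasurable hm]
    filter_upwards [hst 0] with ξ hξ
    constructor
    · rw [← hξ, linearStatistic]
      simp [hΦ₀, measureReal_def]
    · rw [countingMeasure_restrict _ hD, Measure.restrict_apply_univ]
      exact ξ.countingMeasure_ne_top hD hDb
  filter_upwards [hη, ae_ae_of_ae_compProd hcount] with η ⟨N, p, hN, hemb, hac⟩ hc
  refine ⟨N, p, _, hemb.isSigmaFiniteOn,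
    hac.trans ((submanifoldVolume_mutuallyAC p _).map (measurable_ofVector N)), ?_⟩
  filter_upwards [hc] with ξ ⟨h1, h2⟩
  rw [← hN] at h1
  have h3 : ξ.countingMeasure univ = N := by
    rw [← ENNReal.ofReal_toReal h2, ← ENNReal.ofReal_natCast]
    congr 1
    exact_mod_cast h1
  rw [countingMeasure_apply _ .univ, univ_inter] at h3
  exact_mod_cast h3

theorem ae_mutuallyAC_reducedPalm {P : Measure (PointConfig M)} [SFinite P] {k : ℕ}
    {Φ : Fin (k + 1) → M → ℂ} (hΦ : ∀ i, Measurable (Φ i)) (hΦ₀ : ∀ x, Φ 0 x = 1)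
    (htol : ∀ D : Set M, IsOpen D → Bornology.IsBounded D → IsTolerant E P D Φ) {m : ℕ}
    [SigmaFinite (intensityMeasure P m)]
    (hm : intensityMeasure P m ≪ Measure.pi fun _ => riemannianVolume E M)
    {Q₁ : Kernel (Fin m → M) (PointConfig M)} (hQ₁ : IsPalmFamily P m Q₁)
    {Q₂ : Kernel (Fin m → M) (PointConfig M)} (hQ₂ : IsPalmFamily P m Q₂) :
    ∀ᵐ ζ ∂((Measure.pi fun _ : Fin m => riemannianVolume E M).prod
        (Measure.pi fun _ : Fin m => riemannianVolume E M)),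
      (intensityMeasure P m).rnDeriv (Measure.pi fun _ => riemannianVolume E M) ζ.1 ≠ 0 →
      (intensityMeasure P m).rnDeriv (Measure.pi fun _ => riemannianVolume E M) ζ.2 ≠ 0 →
      (∀ i, linearStatistic (Φ i) (vectorMeasure ζ.1) =
            linearStatistic (Φ i) (vectorMeasure ζ.2)) →
        MutuallyAC (reducedPalm Q₁ ζ.1) (reducedPalm Q₂ ζ.2) := by
  have := (hasEuclideanCharts_riemannianVolume E M).sigmaFinite
  obtain ⟨B, hBm, hBo, hb, hcov⟩ := exists_cover_isOpen_isBounded M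
  set ν := Measure.pi fun _ : Fin m => riemannianVolume E M
  -- The zeroth statistic is omitted, being equal to m on all of M^m.
  let S : (Fin m → M) → Fin k → ℂ := fun ζ j => linearStatistic (Φ j.succ) (vectorMeasure ζ)
  have hS : Measurable S := measurable_pi_lambda _ fun j =>
    measurable_linearStatistic_vectorMeasure (hΦ j.succ)
  have hc : {v | 0 < ν (S ⁻¹' {v})}.Countable := countable_meas_pos_of_disjoint_iUnion
    (fun v => hS (measurableSet_singleton v)) fun a b hab =>
      Disjoint.preimage S (disjoint_singleton.2 hab)
  -- One τ serves Q₁ and Q₂, because it comes from the reduced Campbell measure, which does not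
  -- depend on the version of the Palm family. If G is null, almost no ζ satisfies the conditions
  -- and any τ will do.
  have key : ∀ (v : Fin k → ℂ) (R : ℕ), ∃ τ : Measure (PointConfig M), ∀ᵐ ζ ∂ν,
      (intensityMeasure P m).rnDeriv ν ζ ≠ 0 → S ζ = v → (∀ i, ζ i ∈ B R) →
        MutuallyAC (reducedPalm Q₁ ζ) τ ∧ MutuallyAC (reducedPalm Q₂ ζ) τ := fun v R => by
    let G : Set (Fin m → M) := constraintSet (fun j => Φ j.succ) (B R) m v ∩
      {ζ | (intensityMeasure P m).rnDeriv ν ζ ≠ 0}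
    have hG : MeasurableSet G :=
      (measurableSet_constraintSet (fun j => hΦ j.succ) (hBo R).measurableSet m v).inter
        (measurable_rnDeriv _ _ (measurableSet_singleton 0).compl)
    have hGmem : ∀ ζ, (intensityMeasure P m).rnDeriv ν ζ ≠ 0 → S ζ = v → (∀ i, ζ i ∈ B R) →
        ζ ∈ G := fun ζ h0 hv hR => ⟨⟨hR, fun j => congrFun hv j⟩, h0⟩
    by_cases hG0 : ν G = 0
    · refine ⟨0, ?_⟩
      filter_upwards [compl_mem_ae_iff.2 hG0] with ζ hζ h0 hv hR
      exact absurd (hGmem ζ h0 hv hR) hζ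
    · obtain ⟨τ, _, hτ⟩ := (htol (B R) (hBo R) (hb R)).exists_mutuallyAC_bind_splitKernel
        (hBo R).measurableSet (hb R) hΦ hΦ₀ hG inter_subset_left hG0
      refine ⟨τ, ?_⟩
      have h1 := hQ₁.ae_mutuallyAC_reducedPalm hm hG (fun ζ h => h.2) hτ
      have h2 := hQ₂.ae_mutuallyAC_reducedPalm hm hG (fun ζ h => h.2) hτ
      rw [ae_restrict_iff' hG] at h1 h2
      filter_upwards [h1, h2] with ζ h1 h2 h0 hv hR
      exact ⟨h1 (hGmem ζ h0 hv hR), h2 (hGmem ζ h0 hv hR)⟩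
  choose τ hτ using key
  -- The exceptional set depends on v, so only the countably many atoms are allowed;
  -- `ae_prod_eq_imp_pos` shows that this suffices.
  have hall : ∀ᵐ ζ ∂ν, ∀ v ∈ {v | 0 < ν (S ⁻¹' {v})}, ∀ R,
      (intensityMeasure P m).rnDeriv ν ζ ≠ 0 → S ζ = v → (∀ i, ζ i ∈ B R) →
        MutuallyAC (reducedPalm Q₁ ζ) (τ v R) ∧ MutuallyAC (reducedPalm Q₂ ζ) (τ v R) :=
    (ae_ball_iff hc).2 fun v _ => ae_all_iff.2 fun R => hτ v R
  filter_upwards [quasiMeasurePreserving_fst.ae hall, quasiMeasurePreserving_snd.ae hall,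
    ae_prod_eq_imp_pos hS] with ζ h1 h2 h3 h01 h02 heq
  have heq' : S ζ.1 = S ζ.2 := funext fun j => heq j.succ
  choose N₁ hN₁ using fun i => mem_iUnion.1 (hcov.symm ▸ mem_univ (ζ.1 i))
  choose N₂ hN₂ using fun i => mem_iUnion.1 (hcov.symm ▸ mem_univ (ζ.2 i))
  -- The same v and a window containing both vectors give the same τ, through which the two Palm
  -- measures are compared.
  exact (h1 _ (h3 heq') (max (Finset.univ.sup N₁) (Finset.univ.sup N₂)) h01 rfl fun i =>
    hBm ((Finset.le_sup (Finset.mem_univ i)).trans (le_max_left _ _)) (hN₁ i)).1.trans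
    (h2 _ (h3 heq') (max (Finset.univ.sup N₁) (Finset.univ.sup N₂)) h02 heq'.symm fun i =>
    hBm ((Finset.le_sup (Finset.mem_univ i)).trans (le_max_right _ _)) (hN₂ i)).2.symm

end Tolerance

/-! ### The dichotomy. -/

theorem mainTheorem1
    {E : Type*} [NormedAddCommGroup E] [NormedSpace ℝ E] [FiniteDimensional ℝ E]
    {M : Type*} [MetricSpace M] [SecondCountableTopology M]
    [ChartedSpace E M] [IsManifold 𝓘(ℝ, E) ∞ M]
    [Bundle.RiemannianBundle (fun x : M => TangentSpace 𝓘(ℝ, E) x)]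
    [IsContMDiffRiemannianBundle 𝓘(ℝ, E) ∞ E (fun x : M => TangentSpace 𝓘(ℝ, E) x)]
    [IsRiemannianManifold 𝓘(ℝ, E) M]
    [MeasurableSpace M] [BorelSpace M]
    (P : Measure (PointConfig M)) [IsProbabilityMeasure P]
    (hσ : ∀ r : ℕ, SigmaFinite (intensityMeasure P r))
    (hac : ∀ r : ℕ, intensityMeasure P r ≪ Measure.pi fun _ : Fin r => riemannianVolume E M)
    (k : ℕ) (Φ : Fin (k + 1) → M → ℂ)
    (hΦ : ∀ i, ContMDiff 𝓘(ℝ, E) 𝓘(ℝ, ℂ) ∞ (Φ i))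
    (hΦ₀ : ∀ x, Φ 0 x = 1)
    (hrigid : ∀ D : Set M, IsOpen D → Bornology.IsBounded D →
      ∀ i, IsRigidStatistic P D (Φ i))
    (htol : ∀ D : Set M, IsOpen D → Bornology.IsBounded D → IsTolerant E P D Φ)
    (m n : ℕ)
    (Q₁ : Kernel (Fin m → M) (PointConfig M)) (hQ₁ : IsPalmFamily P m Q₁)
    (Q₂ : Kernel (Fin n → M) (PointConfig M)) (hQ₂ : IsPalmFamily P n Q₂) :
    ∀ᵐ ζ ∂((Measure.pi fun _ : Fin m => riemannianVolume E M).prod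
        (Measure.pi fun _ : Fin n => riemannianVolume E M)),
      (intensityMeasure P m).rnDeriv (Measure.pi fun _ => riemannianVolume E M) ζ.1 ≠ 0 →
      (intensityMeasure P n).rnDeriv (Measure.pi fun _ => riemannianVolume E M) ζ.2 ≠ 0 →
      ((∀ i, linearStatistic (Φ i) (vectorMeasure ζ.1) =
            linearStatistic (Φ i) (vectorMeasure ζ.2)) →
          MutuallyAC (reducedPalm Q₁ ζ.1) (reducedPalm Q₂ ζ.2)) ∧
      ((¬ ∀ i, linearStatistic (Φ i) (vectorMeasure ζ.1) =
            linearStatistic (Φ i) (vectorMeasure ζ.2)) →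
          Measure.MutuallySingular (reducedPalm Q₁ ζ.1) (reducedPalm Q₂ ζ.2)) := by
  have : IsManifold 𝓘(ℝ, E) 1 M := .of_le (n := ∞) (by simp)
  have : IsContinuousRiemannianBundle E (fun x : M => TangentSpace 𝓘(ℝ, E) x) := by
    obtain ⟨g, hg, h⟩ := IsContMDiffRiemannianBundle.exists_contMDiff (IB := 𝓘(ℝ, E)) (n := ∞)
      (F := E) (E := fun x : M => TangentSpace 𝓘(ℝ, E) x)
    exact ⟨g, hg.continuous, h⟩
  have := (hasEuclideanCharts_riemannianVolume E M).sigmaFinite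
  have := hσ m
  have := hσ n
  have hΦm : ∀ i, Measurable (Φ i) := fun i => (hΦ i).continuous.measurable
  have hsing := ae_mutuallySingular_reducedPalm hΦm hrigid (hac m) (hac n) hQ₁ hQ₂
  by_cases hmn : m = n
  · subst hmn
    filter_upwards [hsing, ae_mutuallyAC_reducedPalm hΦm hΦ₀ htol (hac m) hQ₁ hQ₂]
      with ζ h1 h2 h01 h02
    exact ⟨h2 h01 h02, h1 h01 h02⟩
  · filter_upwards [hsing] with ζ h1 h01 h02
    -- For m ≠ n equality of statistics is impossible, since the zeroth statistics are m and n.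
    refine ⟨fun heq => absurd ?_ hmn, h1 h01 h02⟩
    have := heq 0
    simp only [linearStatistic_vectorMeasure, hΦ₀, Finset.sum_const, Finset.card_univ,
      Fintype.card_fin, nsmul_eq_mul, mul_one] at this
    exact_mod_cast this

end
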